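/- **Setting.** Let $1\le K\le N$ be integers and let $p_{01},p_{11}\in[0,1]$ with $p_{01}>0$ and $p_{11}<1$ (no absorbing states). There are $N$ independent two-state channels with unit rates, whose states $S_i(t)\in\{0,1\}$ are Markov chains with common transition probabilities $p_{01}=\Pr[0\to1]$ and $p_{11}=\Pr[1\to1]$, and $\Pr[S_i(1)=1]=\omega_i(1)$ for an arbitrary initial belief vector $\Omega(1)\in[0,1]^N$. Write $$\mathcal T(\omega)=\omega p_{11}+(1-\omega)p_{01},\qquad \mathcal T^k=\text{the }k\text{-th iterate of }\mathcal T,\qquad \omega_o=\frac{p_{01}}{p_{01}+1-p_{11}}.$$ In every slot $t$ a policy chooses, as a function of the belief vector $\Omega(t)=(\omega_1(t),\dots,\omega_N(t))$ (and possibly of $t$), a set $U(t)$ of exactly $K$ channels to sense, and collects the reward $R(t)=\sum_{i\in U(t)}S_i(t)$. The beliefs evolve by $\omega_i(t+1)=p_{11}$ if $i\in U(t)$ and $S_i(t)=1$, $\omega_i(t+1)=p_{01}$ if $i\in U(t)$ and $S_i(t)=0$, and $\omega_i(t+1)=\mathcal T(\omega_i(t))$ if $i\notin U(t)$. The throughput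 of a policy is its long-run expected average reward, the limit of $\mathbb E\big[\frac1T\sum_{t=1}^T R(t)\big]$ as $T\to\infty$; where this limit need not exist, it is read as the lower limit throughout, or as the upper limit throughout, and the result is claimed for both readings. Let $J$ be the supremum of the throughput over all policies. **Whittle's index.** For $0<\beta<1$ and $m\in\mathbb R$ let $V_{\beta,m}(\omega)$ be the maximum expected total $\beta$-discounted reward of a single channel with initial belief $\omega$ when in each slot one may activate it (expected reward equal to its current belief; the next belief is $p_{11}$ or $p_{01}$ according to the observed state) or leave it passive (reward $m$; belief updated by $\mathcal T$). The passive action is optimal at $\omega$ for the discount $\beta$ if $m+\beta V_{\beta,m}(\mathcal T(\omega))\ge\omega+\beta\big(\omega V_{\beta,m}(p_{11})+(1-\omega)V_{\beta,m}(p_{01})\big)$, and it is optimal at $\omega$ under the average reward criterion if this holds for all $\beta<1$ sufficiently close to $1$. Whittle's index $W(\omega)$ is the infimum of the subsidies $m$ for which the passive action is optimal at $\omega$ under the average reward criterion. Whittle's index policy senses in each slot $K$ channels with the largest values $W(\omega_i(t))$, where among channels with equal index those with larger belief are preferred, and ties between equal beliefs are broken arbitrarily. Let $J_w$ be its throughput.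 **Theorem.** If $p_{11}\ge p_{01}$, then $$\frac{K\,\mathcal T^{\lfloor N/K\rfloor-1}(p_{01})}{1-p_{11}+\mathcal T^{\lfloor N/K\rfloor-1}(p_{01})}\le J_w\le J\le\min\Big\{\frac{K\omega_o}{1-p_{11}+\omega_o},\ \omega_oN\Big\}.$$ If $p_{11}<p_{01}$, then $$\frac{K\,p_{01}}{1-\mathcal T^{2\lfloor N/K\rfloor-2}(p_{11})+p_{01}}\le J_w\le J\le\min\Big\{\frac{K\,p_{01}}{1-\mathcal T(p_{11})+p_{01}},\ \omega_oN\Big\}.$$ -/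

import Mathlib

open Filter Topology MeasureTheory

/-- One-step belief update of an unobserved channel with transition probabilities
`p01` (bad to good) and `p11` (good to good). Its iterates are the `k`-step updates. -/
def beliefStep (p01 p11 ω : ℝ) : ℝ := ω * p11 + (1 - ω) * p01

/-- The stationary probability of the good state, where `p10 = 1 - p11`. -/
noncomputable def stationaryBelief (p01 p11 : ℝ) : ℝ := p01 / (p01 + (1 - p11))

/-! ### The single-armed bandit process with subsidy, and Whittle's index -/

/-- Expected reward in the slot number `t` (slots are numbered from `0`) of the single-armed
bandit process with subsidy `m` for passivity, started at belief `ω` and operated by the policy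
`u`; `u t ω` tells whether the arm is activated in slot `t` if its belief state is then `ω`. -/
noncomputable def armReward (p01 p11 m : ℝ) : ℕ → (ℕ → ℝ → Bool) → ℝ → ℝ
  | 0, u, ω => if u 0 ω then ω else m
  | t + 1, u, ω =>
      if u 0 ω then
        ω * armReward p01 p11 m t (fun s => u (s + 1)) p11
          + (1 - ω) * armReward p01 p11 m t (fun s => u (s + 1)) p01
      else armReward p01 p11 m t (fun s => u (s + 1)) (beliefStep p01 p11 ω)

/-- The value function: the maximum expected total discounted reward of the single-armed bandit
process with subsidy `m`, over all policies. -/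
noncomputable def armValue (p01 p11 β m ω : ℝ) : ℝ :=
  ⨆ u : ℕ → ℝ → Bool, ∑' t : ℕ, β ^ t * armReward p01 p11 m t u ω

/-- Passive action in the first slot, optimal policy afterwards. -/
noncomputable def armValuePassive (p01 p11 β m ω : ℝ) : ℝ :=
  m + β * armValue p01 p11 β m (beliefStep p01 p11 ω)

/-- Active action in the first slot, optimal policy afterwards. -/
noncomputable def armValueActive (p01 p11 β m ω : ℝ) : ℝ :=
  ω + β * (ω * armValue p01 p11 β m p11 + (1 - ω) * armValue p01 p11 β m p01)

/-- The passive set under subsidy `m`, with discount factor `β`. -/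
def passiveSet (p01 p11 β m : ℝ) : Set ℝ :=
  {ω | ω ∈ Set.Icc (0 : ℝ) 1 ∧ armValueActive p01 p11 β m ω ≤ armValuePassive p01 p11 β m ω}

/-- The passive set under subsidy `m` for the average reward criterion, whose optimal policy is
the pointwise limit of the discounted optimal policies as `β` increases to `1`. -/
def avgPassiveSet (p01 p11 m : ℝ) : Set ℝ :=
  {ω | ∀ᶠ β in 𝓝[<] (1 : ℝ), ω ∈ passiveSet p01 p11 β m}

/-- Whittle's index of the belief state `ω` under the average reward criterion: the infimum
subsidy for which the passive action is optimal at `ω`. -/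
noncomputable def whittleIndex (p01 p11 ω : ℝ) : ℝ :=
  sInf {m : ℝ | ω ∈ avgPassiveSet p01 p11 m}

/-! ### The multi-channel system -/

/-- The probability of the state `b` (`true` is good) if the good state has probability `x`. -/
def stateProb (x : ℝ) (b : Bool) : ℝ := if b then x else 1 - x

/-- `S t w i` is the state of channel `i` in slot `t`. The `N` channels are independent Markov
chains, all with the transition probabilities `p01` and `p11`; channel `i` is initially good with
probability `ω₁ i`. -/
structure IsChannelSystem {X : Type*} [MeasurableSpace X] (P : Measure X) {N : ℕ} (p01 p11 : ℝ)
    (ω₁ : Fin N → ℝ) (S : ℕ → X → Fin N → Bool) : Prop where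
  measurable : ∀ t, Measurable (S t)
  law : ∀ (n : ℕ) (s : ℕ → Fin N → Bool),
    P.real {w | ∀ t ≤ n, S t w = s t} =
      ∏ i : Fin N, (stateProb (ω₁ i) (s 0 i) *
        ∏ t ∈ Finset.range n, stateProb (if s t i then p11 else p01) (s (t + 1) i))

/-- A sensing policy: in every slot it maps the belief vector to a set of `K` channels. -/
def Policy (N K : ℕ) : Type :=
  {π : ℕ → (Fin N → ℝ) → Finset (Fin N) // ∀ t ω, (π t ω).card = K}

/-- The belief vector in each slot, along the path `s` of the channel states. -/
noncomputable def beliefVec {N K : ℕ} (p01 p11 : ℝ) (ω₁ : Fin N → ℝ) (π : Policy N K)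
    (s : ℕ → Fin N → Bool) : ℕ → Fin N → ℝ
  | 0 => ω₁
  | t + 1 => fun i =>
      if i ∈ π.1 t (beliefVec p01 p11 ω₁ π s t) then (if s t i then p11 else p01)
      else beliefStep p01 p11 (beliefVec p01 p11 ω₁ π s t i)

/-- The reward collected in slot `t`: the number of sensed channels that are good. -/
noncomputable def slotReward {N K : ℕ} (p01 p11 : ℝ) (ω₁ : Fin N → ℝ) (π : Policy N K)
    (s : ℕ → Fin N → Bool) (t : ℕ) : ℝ :=
  ∑ i ∈ π.1 t (beliefVec p01 p11 ω₁ π s t), if s t i then 1 else 0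

/-- The expected average reward over the first `T` slots. -/
noncomputable def meanReward {X : Type*} [MeasurableSpace X] (P : Measure X) {N K : ℕ}
    (p01 p11 : ℝ) (ω₁ : Fin N → ℝ) (S : ℕ → X → Fin N → Bool) (π : Policy N K) (T : ℕ) : ℝ :=
  ∫ w, (1 / (T : ℝ)) * ∑ t ∈ Finset.range T, slotReward p01 p11 ω₁ π (fun r => S r w) t ∂P

/-- The long-run expected average reward of a policy, as a lower limit. -/
noncomputable def lowerThroughput {X : Type*} [MeasurableSpace X] (P : Measure X) {N K : ℕ}
    (p01 p11 : ℝ) (ω₁ : Fin N → ℝ) (S : ℕ → X → Fin N → Bool) (π : Policy N K) : ℝ :=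
  liminf (meanReward P p01 p11 ω₁ S π) atTop

/-- The long-run expected average reward of a policy, as an upper limit. -/
noncomputable def upperThroughput {X : Type*} [MeasurableSpace X] (P : Measure X) {N K : ℕ}
    (p01 p11 : ℝ) (ω₁ : Fin N → ℝ) (S : ℕ → X → Fin N → Bool) (π : Policy N K) : ℝ :=
  limsup (meanReward P p01 p11 ω₁ S π) atTop

/-- The optimal long-run expected average reward, in terms of lower limits. -/
noncomputable def lowerOptimal {X : Type*} [MeasurableSpace X] (P : Measure X) {N : ℕ} (K : ℕ)
    (p01 p11 : ℝ) (ω₁ : Fin N → ℝ) (S : ℕ → X → Fin N → Bool) : ℝ :=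
  ⨆ π : Policy N K, lowerThroughput P p01 p11 ω₁ S π

/-- The optimal long-run expected average reward, in terms of upper limits. -/
noncomputable def upperOptimal {X : Type*} [MeasurableSpace X] (P : Measure X) {N : ℕ} (K : ℕ)
    (p01 p11 : ℝ) (ω₁ : Fin N → ℝ) (S : ℕ → X → Fin N → Bool) : ℝ :=
  ⨆ π : Policy N K, upperThroughput P p01 p11 ω₁ S π

/-- Whittle's index policy: in every slot it senses `K` channels with the largest Whittle indices.
Among channels with the same index it prefers a larger belief (the average-reward index is only
weakly increasing in the belief); ties between equal beliefs are broken arbitrarily. -/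
def IsWhittlePolicy {N K : ℕ} (p01 p11 : ℝ) (π : Policy N K) : Prop :=
  ∀ (t : ℕ) (ω : Fin N → ℝ), (∀ i, ω i ∈ Set.Icc (0 : ℝ) 1) →
    ∀ i ∈ π.1 t ω, ∀ j ∉ π.1 t ω,
      whittleIndex p01 p11 (ω j) < whittleIndex p01 p11 (ω i) ∨
        (whittleIndex p01 p11 (ω j) = whittleIndex p01 p11 (ω i) ∧ ω j ≤ ω i)

theorem beliefStep_mem_Icc {p01 p11 x : ℝ} (h01 : p01 ∈ Set.Icc (0 : ℝ) 1)
    (h11 : p11 ∈ Set.Icc (0 : ℝ) 1) (hx : x ∈ Set.Icc (0 : ℝ) 1) :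
    beliefStep p01 p11 x ∈ Set.Icc (0 : ℝ) 1 := by
  obtain ⟨a0, a1⟩ := h01
  obtain ⟨b0, b1⟩ := h11
  obtain ⟨x0, x1⟩ := hx
  unfold beliefStep
  constructor
  · have := mul_nonneg x0 b0
    have := mul_nonneg (sub_nonneg.2 x1) a0
    linarith
  · nlinarith [mul_nonneg x0 (sub_nonneg.2 b1), mul_nonneg (sub_nonneg.2 x1) (sub_nonneg.2 a1)]

theorem beliefStep_combo {p01 p11 x y a b : ℝ} (hab : a + b = 1) :
    beliefStep p01 p11 (a * x + b * y) = a * beliefStep p01 p11 x + b * beliefStep p01 p11 y := by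
  unfold beliefStep
  linear_combination -p01 * hab

theorem beliefStep_one (p01 p11 : ℝ) : beliefStep p01 p11 1 = p11 := by
  simp [beliefStep]

/-- The value function of the single-armed bandit process with horizon `n`. -/
noncomputable def armValueHorizon (p01 p11 β m : ℝ) : ℕ → ℝ → ℝ
  | 0, _ => 0
  | n + 1, ω =>
      max (m + β * armValueHorizon p01 p11 β m n (beliefStep p01 p11 ω))
        (ω + β * (ω * armValueHorizon p01 p11 β m n p11
          + (1 - ω) * armValueHorizon p01 p11 β m n p01))

section SingleArm

variable {p01 p11 β m : ℝ}

theorem abs_armReward_le (h01 : p01 ∈ Set.Icc (0 : ℝ) 1) (h11 : p11 ∈ Set.Icc (0 : ℝ) 1) (t : ℕ) :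
    ∀ (u : ℕ → ℝ → Bool) (ω : ℝ), ω ∈ Set.Icc (0 : ℝ) 1 →
      |armReward p01 p11 m t u ω| ≤ max 1 |m| := by
  induction t with
  | zero =>
    intro u ω hω
    simp only [armReward]
    split_ifs
    · rw [abs_of_nonneg hω.1]
      exact hω.2.trans (le_max_left _ _)
    · exact le_max_right _ _
  | succ t ih =>
    intro u ω hω
    simp only [armReward]
    split_ifs
    · have h1 := abs_le.1 (ih (fun s => u (s + 1)) p11 h11)
      have h2 := abs_le.1 (ih (fun s => u (s + 1)) p01 h01)
      rw [abs_le]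
      constructor <;>
        nlinarith [mul_le_mul_of_nonneg_left h1.1 hω.1, mul_le_mul_of_nonneg_left h1.2 hω.1,
          mul_le_mul_of_nonneg_left h2.1 (sub_nonneg.2 hω.2),
          mul_le_mul_of_nonneg_left h2.2 (sub_nonneg.2 hω.2)]
    · exact ih _ _ (beliefStep_mem_Icc h01 h11 hω)

theorem sum_armReward_succ (n : ℕ) (u : ℕ → ℝ → Bool) (ω : ℝ) :
    ∑ t ∈ Finset.range (n + 1), β ^ t * armReward p01 p11 m t u ω =
      if u 0 ω then
        ω + β * (ω * ∑ t ∈ Finset.range n, β ^ t * armReward p01 p11 m t (fun s => u (s + 1)) p11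
          + (1 - ω) *
            ∑ t ∈ Finset.range n, β ^ t * armReward p01 p11 m t (fun s => u (s + 1)) p01)
      else m + β * ∑ t ∈ Finset.range n,
        β ^ t * armReward p01 p11 m t (fun s => u (s + 1)) (beliefStep p01 p11 ω) := by
  rw [Finset.sum_range_succ']
  by_cases h : u 0 ω
  · simp only [armReward, h, if_true, Finset.mul_sum, mul_add, ← Finset.sum_add_distrib]
    rw [add_comm]
    congr 1
    · ring
    · exact Finset.sum_congr rfl fun t _ => by ring
  · simp only [armReward, h, Finset.mul_sum]
    rw [add_comm]
    congr 1
    · simp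
    · exact Finset.sum_congr rfl fun t _ => by simp; ring

theorem sum_armReward_le (h01 : p01 ∈ Set.Icc (0 : ℝ) 1) (h11 : p11 ∈ Set.Icc (0 : ℝ) 1)
    (hβ : 0 ≤ β) (n : ℕ) : ∀ (u : ℕ → ℝ → Bool) (ω : ℝ), ω ∈ Set.Icc (0 : ℝ) 1 →
      ∑ t ∈ Finset.range n, β ^ t * armReward p01 p11 m t u ω ≤
        armValueHorizon p01 p11 β m n ω := by
  induction n with
  | zero => intro u ω _; simp [armValueHorizon]
  | succ n ih =>
    intro u ω hω
    rw [sum_armReward_succ, armValueHorizon]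
    split_ifs
    · refine le_trans ?_ (le_max_right _ _)
      gcongr
      · exact hω.1
      · exact ih _ _ h11
      · exact sub_nonneg.2 hω.2
      · exact ih _ _ h01
    · refine le_trans ?_ (le_max_left _ _)
      gcongr
      exact ih _ _ (beliefStep_mem_Icc h01 h11 hω)

theorem exists_sum_armReward_eq (n : ℕ) : ∃ u : ℕ → ℝ → Bool, ∀ ω,
    ∑ t ∈ Finset.range n, β ^ t * armReward p01 p11 m t u ω =
      armValueHorizon p01 p11 β m n ω := by
  classical
  induction n with
  | zero => exact ⟨fun _ _ => true, fun ω => by simp [armValueHorizon]⟩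
  | succ n ih =>
    obtain ⟨v, hv⟩ := ih
    let d : ℝ → Bool := fun ω =>
      decide (m + β * armValueHorizon p01 p11 β m n (beliefStep p01 p11 ω) ≤
        ω + β * (ω * armValueHorizon p01 p11 β m n p11
          + (1 - ω) * armValueHorizon p01 p11 β m n p01))
    refine ⟨fun t => Nat.casesOn t d v, fun ω => ?_⟩
    rw [sum_armReward_succ, armValueHorizon]
    simp only [hv]
    split_ifs with h
    · exact (max_eq_right (of_decide_eq_true h)).symm
    · exact (max_eq_left (not_le.1 (mt decide_eq_true h)).le).symm

theorem summable_armReward (h01 : p01 ∈ Set.Icc (0 : ℝ) 1) (h11 : p11 ∈ Set.Icc (0 : ℝ) 1)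
    (hβ : 0 ≤ β) (hβ1 : β < 1) (u : ℕ → ℝ → Bool) {ω : ℝ} (hω : ω ∈ Set.Icc (0 : ℝ) 1) :
    Summable fun t => β ^ t * armReward p01 p11 m t u ω := by
  refine Summable.of_norm_bounded (g := fun t => β ^ t * max 1 |m|)
    ((summable_geometric_of_lt_one hβ hβ1).mul_right _) fun t => ?_
  rw [norm_mul, norm_pow, Real.norm_of_nonneg hβ]
  exact mul_le_mul_of_nonneg_left (abs_armReward_le h01 h11 t u ω hω) (by positivity)

theorem abs_tsum_sub_sum_le (h01 : p01 ∈ Set.Icc (0 : ℝ) 1) (h11 : p11 ∈ Set.Icc (0 : ℝ) 1)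
    (hβ : 0 ≤ β) (hβ1 : β < 1) (u : ℕ → ℝ → Bool) {ω : ℝ} (hω : ω ∈ Set.Icc (0 : ℝ) 1) (n : ℕ) :
    |∑' t, β ^ t * armReward p01 p11 m t u ω
      - ∑ t ∈ Finset.range n, β ^ t * armReward p01 p11 m t u ω| ≤
      max 1 |m| * (1 - β)⁻¹ * β ^ n := by
  have hs := summable_armReward (m := m) h01 h11 hβ hβ1 u hω
  rw [← hs.sum_add_tsum_nat_add n, add_sub_cancel_left]
  have hg : HasSum (fun t => β ^ n * max 1 |m| * β ^ t) (β ^ n * max 1 |m| * (1 - β)⁻¹) :=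
    (hasSum_geometric_of_lt_one hβ hβ1).mul_left _
  rw [show max 1 |m| * (1 - β)⁻¹ * β ^ n = β ^ n * max 1 |m| * (1 - β)⁻¹ by ring]
  refine tsum_of_norm_bounded (E := ℝ) hg fun t => ?_
  change ‖β ^ (t + n) * armReward p01 p11 m (t + n) u ω‖ ≤ _
  rw [norm_mul, norm_pow, Real.norm_of_nonneg hβ, pow_add, mul_comm (β ^ t), mul_assoc, mul_assoc]
  refine mul_le_mul_of_nonneg_left ?_ (by positivity)
  rw [mul_comm]
  exact mul_le_mul_of_nonneg_right (abs_armReward_le h01 h11 _ u ω hω) (by positivity)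

theorem tendsto_armValueHorizon (h01 : p01 ∈ Set.Icc (0 : ℝ) 1) (h11 : p11 ∈ Set.Icc (0 : ℝ) 1)
    (hβ : 0 ≤ β) (hβ1 : β < 1) {ω : ℝ} (hω : ω ∈ Set.Icc (0 : ℝ) 1) :
    Tendsto (fun n => armValueHorizon p01 p11 β m n ω) atTop (𝓝 (armValue p01 p11 β m ω)) := by
  set C := max 1 |m| * (1 - β)⁻¹
  have hup : ∀ n (u : ℕ → ℝ → Bool), ∑' t, β ^ t * armReward p01 p11 m t u ω ≤
      armValueHorizon p01 p11 β m n ω + C * β ^ n := fun n u => by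
    have h1 := (abs_le.1 (abs_tsum_sub_sum_le (m := m) h01 h11 hβ hβ1 u hω n)).2
    have h2 := sum_armReward_le (m := m) h01 h11 hβ n u ω hω
    linarith
  have hbdd : BddAbove (Set.range fun u : ℕ → ℝ → Bool =>
      ∑' t, β ^ t * armReward p01 p11 m t u ω) :=
    ⟨_, Set.forall_mem_range.2 (hup 0)⟩
  have hε : Tendsto (fun n : ℕ => C * β ^ n) atTop (𝓝 0) := by
    simpa using (tendsto_pow_atTop_nhds_zero_of_lt_one hβ hβ1).const_mul C
  refine tendsto_iff_dist_tendsto_zero.2 (squeeze_zero (fun _ => dist_nonneg) (fun n => ?_) hε)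
  rw [Real.dist_eq, abs_le]
  have h1 : armValue p01 p11 β m ω ≤ armValueHorizon p01 p11 β m n ω + C * β ^ n :=
    ciSup_le (hup n)
  obtain ⟨u, hu⟩ := exists_sum_armReward_eq (p01 := p01) (p11 := p11) (β := β) (m := m) n
  have h2 := le_ciSup hbdd u
  have h3 := (abs_le.1 (abs_tsum_sub_sum_le (m := m) h01 h11 hβ hβ1 u hω n)).1
  rw [hu] at h3
  change _ ≤ armValue p01 p11 β m ω at h2
  constructor <;> linarith

theorem convexOn_armValueHorizon (h01 : p01 ∈ Set.Icc (0 : ℝ) 1) (h11 : p11 ∈ Set.Icc (0 : ℝ) 1)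
    (hβ : 0 ≤ β) (n : ℕ) : ConvexOn ℝ (Set.Icc 0 1) (armValueHorizon p01 p11 β m n) := by
  induction n with
  | zero => exact convexOn_const 0 (convex_Icc 0 1)
  | succ n ih =>
    refine ConvexOn.sup (f := fun ω => m + β * armValueHorizon p01 p11 β m n (beliefStep p01 p11 ω))
      (g := fun ω => ω + β * (ω * armValueHorizon p01 p11 β m n p11
          + (1 - ω) * armValueHorizon p01 p11 β m n p01)) ⟨convex_Icc 0 1, ?_⟩ ⟨convex_Icc 0 1, ?_⟩
    · intro x hx y hy a b ha hb hab
      have h := ih.2 (beliefStep_mem_Icc h01 h11 hx) (beliefStep_mem_Icc h01 h11 hy) ha hb hab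
      simp only [smul_eq_mul] at h ⊢
      rw [beliefStep_combo hab]
      have := mul_le_mul_of_nonneg_left h hβ
      linear_combination this - m * hab
    · intro x _ y _ a b _ _ hab
      simp only [smul_eq_mul]
      refine le_of_eq ?_
      linear_combination -(β * armValueHorizon p01 p11 β m n p01) * hab

theorem convexOn_armValue (h01 : p01 ∈ Set.Icc (0 : ℝ) 1) (h11 : p11 ∈ Set.Icc (0 : ℝ) 1)
    (hβ : 0 ≤ β) (hβ1 : β < 1) : ConvexOn ℝ (Set.Icc 0 1) (armValue p01 p11 β m) := by
  refine ⟨convex_Icc 0 1, fun x hx y hy a b ha hb hab => ?_⟩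
  exact le_of_tendsto_of_tendsto'
    (tendsto_armValueHorizon h01 h11 hβ hβ1 ((convex_Icc (0 : ℝ) 1) hx hy ha hb hab))
    (((tendsto_armValueHorizon h01 h11 hβ hβ1 hx).const_mul a).add
      ((tendsto_armValueHorizon h01 h11 hβ hβ1 hy).const_mul b))
    fun n => (convexOn_armValueHorizon h01 h11 hβ n).2 hx hy ha hb hab

/-- With a subsidy of at least `1` the value function is constant. -/
theorem armValue_eq_of_one_le (h01 : p01 ∈ Set.Icc (0 : ℝ) 1) (h11 : p11 ∈ Set.Icc (0 : ℝ) 1)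
    (hβ : 0 ≤ β) (hβ1 : β < 1) (hm : 1 ≤ m) {x y : ℝ} (hx : x ∈ Set.Icc (0 : ℝ) 1)
    (hy : y ∈ Set.Icc (0 : ℝ) 1) : armValue p01 p11 β m x = armValue p01 p11 β m y := by
  have key : ∀ n, ∃ c, ∀ z ∈ Set.Icc (0 : ℝ) 1, armValueHorizon p01 p11 β m n z = c := by
    intro n
    induction n with
    | zero => exact ⟨0, fun _ _ => rfl⟩
    | succ n ih =>
      obtain ⟨c, hc⟩ := ih
      refine ⟨m + β * c, fun z hz => ?_⟩
      rw [armValueHorizon, hc _ (beliefStep_mem_Icc h01 h11 hz), hc _ h01, hc _ h11]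
      refine max_eq_left ?_
      have := hz.2
      nlinarith
  refine tendsto_nhds_unique (tendsto_armValueHorizon h01 h11 hβ hβ1 hx) ?_
  refine (tendsto_armValueHorizon h01 h11 hβ hβ1 hy).congr fun n => ?_
  obtain ⟨c, hc⟩ := key n
  rw [hc x hx, hc y hy]

theorem passiveSet_of_one_le (h01 : p01 ∈ Set.Icc (0 : ℝ) 1) (h11 : p11 ∈ Set.Icc (0 : ℝ) 1)
    (hβ : 0 ≤ β) (hβ1 : β < 1) (hm : 1 ≤ m) {x : ℝ} (hx : x ∈ Set.Icc (0 : ℝ) 1) :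
    x ∈ passiveSet p01 p11 β m := by
  refine ⟨hx, ?_⟩
  unfold armValueActive armValuePassive
  rw [armValue_eq_of_one_le h01 h11 hβ hβ1 hm (beliefStep_mem_Icc h01 h11 hx) h01,
    armValue_eq_of_one_le h01 h11 hβ hβ1 hm h11 h01]
  have := hx.2
  linarith

/-- The optimal policy of a single arm is a threshold policy. -/
theorem passiveSet_downward_closed (h01 : p01 ∈ Set.Icc (0 : ℝ) 1)
    (h11 : p11 ∈ Set.Icc (0 : ℝ) 1) (hβ : 0 ≤ β) (hβ1 : β < 1) {x y : ℝ}
    (hx : x ∈ Set.Icc (0 : ℝ) 1) (hxy : x ≤ y) (hy : y ∈ passiveSet p01 p11 β m) :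
    x ∈ passiveSet p01 p11 β m := by
  rcases le_or_gt 1 m with hm | hm
  · exact passiveSet_of_one_le h01 h11 hβ hβ1 hm hx
  rcases hxy.eq_or_lt with rfl | hlt
  · exact hy
  refine ⟨hx, ?_⟩
  obtain ⟨hy, hya⟩ := hy
  have hx1 : 0 < 1 - x := by linarith [hy.2]
  set a := (1 - y) / (1 - x)
  set b := (y - x) / (1 - x)
  have ha : 0 ≤ a := div_nonneg (sub_nonneg.2 hy.2) hx1.le
  have hb : 0 < b := div_pos (sub_pos.2 hlt) hx1
  have hab : a + b = 1 := by simp only [a, b]; field_simp; ring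
  have hyc : y = a * x + b * 1 := by simp only [a, b]; field_simp; ring
  have hTy : beliefStep p01 p11 y = a * beliefStep p01 p11 x + b * p11 := by
    rw [hyc, beliefStep_combo hab, beliefStep_one]
  have hc := (convexOn_armValue (m := m) h01 h11 hβ hβ1).2 (beliefStep_mem_Icc h01 h11 hx) h11
    ha hb.le hab
  simp only [smul_eq_mul] at hc
  rw [← hTy] at hc
  unfold armValueActive armValuePassive at hya ⊢
  set V := armValue p01 p11 β m
  have h1 := mul_le_mul_of_nonneg_left hc hβ
  have h2 : 0 < a * (m + β * V (beliefStep p01 p11 x) - (x + β * (x * V p11 + (1 - x) * V p01))) := by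
    have h3 : b * m < b * 1 := mul_lt_mul_of_pos_left hm hb
    have h4 : a * (m + β * V (beliefStep p01 p11 x) - (x + β * (x * V p11 + (1 - x) * V p01))) =
        m + β * (a * V (beliefStep p01 p11 x) + b * V p11)
          - (y + β * (y * V p11 + (1 - y) * V p01)) - b * m + b * 1 := by
      rw [hyc]
      linear_combination (m - β * V p01) * hab
    linarith
  linarith [pos_of_mul_pos_right h2 ha]

theorem nonneg_of_mem_avgPassiveSet (h01 : p01 ∈ Set.Icc (0 : ℝ) 1) (h11 : p11 ∈ Set.Icc (0 : ℝ) 1)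
    {x : ℝ} (hx : x ∈ avgPassiveSet p01 p11 m) : 0 ≤ m := by
  have hβ : ∀ᶠ β in 𝓝[<] (1 : ℝ), β ∈ Set.Ioo (0 : ℝ) 1 := Ioo_mem_nhdsLT one_pos
  obtain ⟨β, ⟨hI, ha⟩, hβ0, hβ1⟩ :=
    (Filter.Eventually.and (show ∀ᶠ β in 𝓝[<] (1 : ℝ), x ∈ passiveSet p01 p11 β m from hx) hβ).exists
  have hc := (convexOn_armValue (m := m) h01 h11 hβ0.le hβ1).2 h11 h01 hI.1 (sub_nonneg.2 hI.2)
    (by ring)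
  unfold armValueActive armValuePassive at ha
  have h1 := mul_le_mul_of_nonneg_left hc hβ0.le
  simp only [smul_eq_mul] at h1
  rw [beliefStep] at ha
  linarith [hI.1]

/-- Whittle's index is weakly increasing in the belief. -/
theorem whittleIndex_mono (h01 : p01 ∈ Set.Icc (0 : ℝ) 1) (h11 : p11 ∈ Set.Icc (0 : ℝ) 1)
    {x y : ℝ} (hx : x ∈ Set.Icc (0 : ℝ) 1) (hy : y ∈ Set.Icc (0 : ℝ) 1) (hxy : x ≤ y) :
    whittleIndex p01 p11 x ≤ whittleIndex p01 p11 y := by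
  have hβ : ∀ᶠ β in 𝓝[<] (1 : ℝ), β ∈ Set.Ioo (0 : ℝ) 1 := Ioo_mem_nhdsLT one_pos
  refine csInf_le_csInf ⟨0, fun m hm => nonneg_of_mem_avgPassiveSet h01 h11 hm⟩ ⟨1, ?_⟩ ?_
  · filter_upwards [hβ] with β hβ using passiveSet_of_one_le h01 h11 hβ.1.le hβ.2 le_rfl hy
  · intro m hm
    change ∀ᶠ β in 𝓝[<] (1 : ℝ), y ∈ passiveSet p01 p11 β m at hm
    change ∀ᶠ β in 𝓝[<] (1 : ℝ), x ∈ passiveSet p01 p11 β m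
    filter_upwards [hβ, hm] with β hβ hm using
      passiveSet_downward_closed h01 h11 hβ.1.le hβ.2 hx hxy hm

/-- Whittle's index policy is the myopic policy. -/
theorem IsWhittlePolicy.belief_le {N K : ℕ} {π : Policy N K} (hπ : IsWhittlePolicy p01 p11 π)
    (h01 : p01 ∈ Set.Icc (0 : ℝ) 1) (h11 : p11 ∈ Set.Icc (0 : ℝ) 1) {t : ℕ} {ω : Fin N → ℝ}
    (hω : ∀ i, ω i ∈ Set.Icc (0 : ℝ) 1) {i j : Fin N} (hi : i ∈ π.1 t ω) (hj : j ∉ π.1 t ω) :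
    ω j ≤ ω i := by
  rcases hπ t ω hω i hi j hj with h | h
  · by_contra! hlt
    exact absurd (whittleIndex_mono h01 h11 (hω i) (hω j) hlt.le) (not_le.2 h)
  · exact h.2

end SingleArm
theorem sum_stateProb (x : ℝ) : ∑ b, stateProb x b = 1 := by
  simp [stateProb]

theorem sum_stateProb_mul (x : ℝ) (f : Bool → ℝ) :
    ∑ b, stateProb x b * f b = x * f true + (1 - x) * f false := by
  simp [stateProb]

section ProductWeights

variable {ι : Type*} [Fintype ι] [DecidableEq ι]

theorem sum_prod_mul_split (w : ι → Bool → ℝ) (i : ι) (g : (ι → Bool) → ℝ) (f : Bool → ℝ)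
    (hg : ∀ s b, g (Function.update s i b) = g s) :
    ∑ s, (∏ j, w j (s j)) * (g s * f (s i)) =
      (∑ b, w i b * f b) * ∑ r : {j // j ≠ i} → Bool,
        (∏ j : {j // j ≠ i}, w j (r j)) * g ((Equiv.funSplitAt i Bool).symm (true, r)) := by
  rw [← (Equiv.funSplitAt i Bool).symm.sum_comp, Fintype.sum_prod_type, Finset.sum_mul]
  refine Finset.sum_congr rfl fun b _ => ?_
  rw [Finset.mul_sum]
  refine Finset.sum_congr rfl fun r _ => ?_
  have h1 : (Equiv.funSplitAt i Bool).symm (b, r) i = b := by simp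
  have h2 : g ((Equiv.funSplitAt i Bool).symm (b, r)) =
      g ((Equiv.funSplitAt i Bool).symm (true, r)) := by
    rw [← hg _ true]
    congr 1
    ext j
    by_cases h : j = i
    · subst h; simp
    · simp [h]
  have h3 : ∏ j : {j // j ≠ i}, w j ((Equiv.funSplitAt i Bool).symm (b, r) j) =
      ∏ j : {j // j ≠ i}, w j (r j) :=
    Finset.prod_congr rfl fun j _ => by simp [j.2]
  rw [Fintype.prod_eq_mul_prod_subtype_ne _ i, h1, h2, h3]
  ring

/-- Under a product weight a function of the coordinate `i` is independent of a function of the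
other coordinates. -/
theorem sum_prod_mul_coord (w : ι → Bool → ℝ) (i : ι) (g : (ι → Bool) → ℝ) (f : Bool → ℝ)
    (hg : ∀ s b, g (Function.update s i b) = g s) (hw : ∑ b, w i b = 1) :
    ∑ s, (∏ j, w j (s j)) * (g s * f (s i)) =
      (∑ b, w i b * f b) * ∑ s, (∏ j, w j (s j)) * g s := by
  have h := sum_prod_mul_split w i g (fun _ => 1) hg
  simp only [mul_one, hw, one_mul] at h
  rw [sum_prod_mul_split w i g f hg, h]

theorem sum_prod_mul_congr (w w' : ι → Bool → ℝ) (i : ι) (g : (ι → Bool) → ℝ)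
    (hg : ∀ s b, g (Function.update s i b) = g s) (hw : ∑ b, w i b = 1) (hw' : ∑ b, w' i b = 1)
    (h : ∀ j ≠ i, w j = w' j) :
    ∑ s, (∏ j, w j (s j)) * g s = ∑ s, (∏ j, w' j (s j)) * g s := by
  have h1 := sum_prod_mul_split w i g (fun _ => 1) hg
  have h2 := sum_prod_mul_split w' i g (fun _ => 1) hg
  simp only [mul_one, hw, hw', one_mul] at h1 h2
  rw [h1, h2]
  refine Finset.sum_congr rfl fun r _ => ?_
  congr 1
  exact Finset.prod_congr rfl fun j _ => by rw [h j j.2]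

end ProductWeights

section Beliefs

variable {N K : ℕ} {p01 p11 : ℝ} {ω₁ : Fin N → ℝ} {π : Policy N K}

theorem beliefVec_congr {s s' : ℕ → Fin N → Bool} {n : ℕ} (h : ∀ t < n, s t = s' t) :
    beliefVec p01 p11 ω₁ π s n = beliefVec p01 p11 ω₁ π s' n := by
  induction n with
  | zero => rfl
  | succ n ih =>
    simp only [beliefVec]
    rw [ih fun t ht => h t (ht.trans (Nat.lt_succ_self n)), h n (Nat.lt_succ_self n)]

theorem beliefVec_mem_Icc (h01 : p01 ∈ Set.Icc (0 : ℝ) 1) (h11 : p11 ∈ Set.Icc (0 : ℝ) 1)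
    (hω₁ : ∀ i, ω₁ i ∈ Set.Icc (0 : ℝ) 1) (s : ℕ → Fin N → Bool) (t : ℕ) (i : Fin N) :
    beliefVec p01 p11 ω₁ π s t i ∈ Set.Icc (0 : ℝ) 1 := by
  induction t with
  | zero => exact hω₁ i
  | succ t ih =>
    simp only [beliefVec]
    split_ifs
    · exact h11
    · exact h01
    · exact beliefStep_mem_Icc h01 h11 ih

end Beliefs

section Channels

variable {X : Type*} [MeasurableSpace X] {P : Measure X} [IsProbabilityMeasure P]
  {N : ℕ} {p01 p11 : ℝ} {ω₁ : Fin N → ℝ} {S : ℕ → X → Fin N → Bool}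

theorem IsChannelSystem.integrable (hS : IsChannelSystem P p01 p11 ω₁ S) (n : ℕ)
    {F : (ℕ → Fin N → Bool) → ℝ} (hF : DependsOn F (Set.Iic n)) :
    Integrable (fun w => F fun r => S r w) P := by
  let Y : X → (Fin (n + 1) → Fin N → Bool) := fun w k => S k w
  have hY : Measurable Y := measurable_pi_lambda _ fun k => hS.measurable k
  let e : (Fin (n + 1) → Fin N → Bool) → ℕ → Fin N → Bool :=
    fun p t => if h : t < n + 1 then p ⟨t, h⟩ else fun _ => false
  have hI : Integrable (fun p => F (e p)) (P.map Y) := Integrable.of_finite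
  refine (hI.comp_measurable hY).congr (Eventually.of_forall fun w => hF fun t ht => ?_)
  simp only [e, Y, dif_pos (Nat.lt_succ_of_le (Set.mem_Iic.1 ht))]

theorem IsChannelSystem.integral_zero (hS : IsChannelSystem P p01 p11 ω₁ S)
    (G : (Fin N → Bool) → ℝ) :
    ∫ w, G (S 0 w) ∂P = ∑ s, (∏ i, stateProb (ω₁ i) (s i)) * G s := by
  have hI : Integrable G (P.map (S 0)) := Integrable.of_finite
  rw [← integral_map (hS.measurable 0).aemeasurable hI.aestronglyMeasurable, integral_fintype hI]
  refine Finset.sum_congr rfl fun s _ => ?_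
  have h := hS.law 0 fun _ => s
  simp only [Nat.le_zero, forall_eq, Finset.range_zero, Finset.prod_empty, mul_one] at h
  rw [map_measureReal_apply (hS.measurable 0) (measurableSet_singleton s), smul_eq_mul, ← h]
  rfl

/-- The Markov property. -/
theorem IsChannelSystem.integral_succ (hS : IsChannelSystem P p01 p11 ω₁ S) (n : ℕ)
    {G : (ℕ → Fin N → Bool) → (Fin N → Bool) → ℝ} (hG : DependsOn G (Set.Iic n)) :
    ∫ w, G (fun r => S r w) (S (n + 1) w) ∂P =
      ∫ w, ∑ s', (∏ i, stateProb (if S n w i then p11 else p01) (s' i)) *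
        G (fun r => S r w) s' ∂P := by
  let Y : X → (Fin (n + 1) → Fin N → Bool) := fun w k => S k w
  have hY : Measurable Y := measurable_pi_lambda _ fun k => hS.measurable k
  let Z : X → (Fin (n + 1) → Fin N → Bool) × (Fin N → Bool) := fun w => (Y w, S (n + 1) w)
  have hZ : Measurable Z := hY.prodMk (hS.measurable (n + 1))
  let e : (Fin (n + 1) → Fin N → Bool) → (Fin N → Bool) → ℕ → Fin N → Bool :=
    fun p s t => if h : t < n + 1 then p ⟨t, h⟩ else s
  have heq : ∀ p s (w : X), (∀ t ≤ n, S t w = e p s t) ↔ Y w = p := by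
    intro p s w
    constructor
    · intro h
      ext1 k
      have := h k (Nat.le_of_lt_succ k.2)
      simpa only [e, Y, dif_pos k.2] using this
    · rintro rfl t ht
      simp only [e, Y, dif_pos (Nat.lt_succ_of_le ht)]
  have hGe : ∀ w s, G (fun r => S r w) = G (e (Y w) s) := fun w s => hG fun t ht =>
    ((heq (Y w) s w).2 rfl t ht)
  have hlaw : ∀ p s, (P.map Z).real {(p, s)} =
      (P.map Y).real {p} * ∏ i, stateProb (if p (Fin.last n) i then p11 else p01) (s i) := by
    intro p s
    rw [map_measureReal_apply hZ (measurableSet_singleton _),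
      map_measureReal_apply hY (measurableSet_singleton _)]
    have h1 := hS.law (n + 1) (e p s)
    have h0 := hS.law n (e p s)
    have hs1 : {w | ∀ t ≤ n + 1, S t w = e p s t} = Z ⁻¹' {(p, s)} := by
      ext w
      have hl : e p s (n + 1) = s := by simp [e]
      simp only [Set.mem_ofPred_eq, Set.mem_preimage, Set.mem_singleton_iff, Z, Prod.mk.injEq]
      rw [← heq p s w]
      constructor
      · exact fun h => ⟨fun t ht => h t (ht.trans n.le_succ), by rw [h _ le_rfl, hl]⟩
      · rintro ⟨h, h'⟩ t ht
        rcases ht.lt_or_eq with h2 | rfl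
        · exact h t (Nat.le_of_lt_succ h2)
        · rw [h', hl]
    have hs0 : {w | ∀ t ≤ n, S t w = e p s t} = Y ⁻¹' {p} := by
      ext w
      exact heq p s w
    rw [hs1] at h1
    rw [hs0] at h0
    rw [h1, h0, ← Finset.prod_mul_distrib]
    refine Finset.prod_congr rfl fun i _ => ?_
    rw [Finset.prod_range_succ, mul_assoc]
    simp [e, Fin.last]
  let s₀ : Fin N → Bool := fun _ => false
  have hL : Integrable (fun z : (Fin (n + 1) → Fin N → Bool) × (Fin N → Bool) =>
      G (e z.1 s₀) z.2) (P.map Z) := Integrable.of_finite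
  have hR : Integrable (fun p : Fin (n + 1) → Fin N → Bool =>
      ∑ s', (∏ i, stateProb (if p (Fin.last n) i then p11 else p01) (s' i)) * G (e p s₀) s')
      (P.map Y) := Integrable.of_finite
  have eL : ∫ w, G (fun r => S r w) (S (n + 1) w) ∂P =
      ∫ z, G (e z.1 s₀) z.2 ∂(P.map Z) := by
    rw [integral_map hZ.aemeasurable hL.aestronglyMeasurable]
    exact integral_congr_ae (Eventually.of_forall fun w => by simp only [hGe w s₀, Z])
  have eR : ∫ w, ∑ s', (∏ i, stateProb (if S n w i then p11 else p01) (s' i)) *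
        G (fun r => S r w) s' ∂P =
      ∫ p, ∑ s', (∏ i, stateProb (if p (Fin.last n) i then p11 else p01) (s' i)) * G (e p s₀) s'
        ∂(P.map Y) := by
    rw [integral_map hY.aemeasurable hR.aestronglyMeasurable]
    exact integral_congr_ae (Eventually.of_forall fun w => by
      simp only [hGe w s₀, Y, Fin.val_last])
  rw [eL, eR, integral_fintype hL, integral_fintype hR, Fintype.sum_prod_type]
  refine Finset.sum_congr rfl fun p _ => ?_
  rw [Finset.smul_sum]
  refine Finset.sum_congr rfl fun s _ => ?_
  rw [hlaw]
  simp only [smul_eq_mul]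
  ring

variable {K : ℕ} {π : Policy N K}

theorem IsChannelSystem.integrable_belief_state (hS : IsChannelSystem P p01 p11 ω₁ S) (t : ℕ)
    (G : (Fin N → ℝ) → (Fin N → Bool) → ℝ) :
    Integrable (fun w => G (beliefVec p01 p11 ω₁ π (fun r => S r w) t) (S t w)) P :=
  hS.integrable t (F := fun s => G (beliefVec p01 p11 ω₁ π s t) (s t)) fun s s' h => by
    simp only
    rw [beliefVec_congr fun r hr => h r (Set.mem_Iic.2 hr.le), h t (Set.mem_Iic.2 le_rfl)]

/-- Given the past observations and the current states of the other channels, the belief of a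
channel is the probability that it is good. -/
theorem IsChannelSystem.integral_mul_state (hS : IsChannelSystem P p01 p11 ω₁ S) (t : ℕ) :
    ∀ (i : Fin N) (G : (Fin N → ℝ) → (Fin N → Bool) → ℝ),
      (∀ ω s b, G ω (Function.update s i b) = G ω s) →
      ∫ w, G (beliefVec p01 p11 ω₁ π (fun r => S r w) t) (S t w) * (if S t w i then 1 else 0) ∂P =
        ∫ w, G (beliefVec p01 p11 ω₁ π (fun r => S r w) t) (S t w) *
          beliefVec p01 p11 ω₁ π (fun r => S r w) t i ∂P := by
  induction t with
  | zero =>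
    intro i G hG
    simp only [beliefVec]
    rw [hS.integral_zero fun s => G ω₁ s * if s i then 1 else 0,
      hS.integral_zero fun s => G ω₁ s * ω₁ i,
      sum_prod_mul_coord (fun j => stateProb (ω₁ j)) i (G ω₁) (fun b => if b then 1 else 0) (hG ω₁)
        (sum_stateProb _),
      sum_stateProb_mul, Finset.mul_sum]
    exact Finset.sum_congr rfl fun s _ => by simp; ring
  | succ t ih =>
    intro i G hG
    let H : (Fin N → ℝ) → (Fin N → Bool) → ℝ := fun ω s =>
      ∑ s', (∏ j, stateProb (if s j then p11 else p01) (s' j)) * G ω s'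
    have hH : ∀ ω s b, H ω (Function.update s i b) = H ω s := fun ω s b =>
      sum_prod_mul_congr _ _ i (G ω) (hG ω) (sum_stateProb _) (sum_stateProb _) fun j hj => by
        simp [hj]
    let Ψ : (Fin N → ℝ) → (Fin N → Bool) → Fin N → ℝ := fun ω s j =>
      if j ∈ π.1 t ω then (if s j then p11 else p01) else beliefStep p01 p11 (ω j)
    have hΨ : ∀ s : ℕ → Fin N → Bool, beliefVec p01 p11 ω₁ π s (t + 1) =
      Ψ (beliefVec p01 p11 ω₁ π s t) (s t) := fun s => rfl
    have hdep : DependsOn (fun s : ℕ → Fin N → Bool => beliefVec p01 p11 ω₁ π s (t + 1))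
        (Set.Iic t) := fun s s' h =>
      beliefVec_congr fun r hr => h r (Set.mem_Iic.2 (Nat.le_of_lt_succ hr))
    rw [hS.integral_succ t (G := fun s s' => G (beliefVec p01 p11 ω₁ π s (t + 1)) s' *
        if s' i then 1 else 0) fun s s' h => by simp only [hdep h],
      hS.integral_succ t (G := fun s s' => G (beliefVec p01 p11 ω₁ π s (t + 1)) s' *
        beliefVec p01 p11 ω₁ π s (t + 1) i) fun s s' h => by simp only [hdep h]]
    have hl : ∀ ω s, ∑ s', (∏ j, stateProb (if s j then p11 else p01) (s' j)) *
        (G ω s' * if s' i then 1 else 0) = (if s i then p11 else p01) * H ω s := by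
      intro ω s
      rw [sum_prod_mul_coord (fun j => stateProb (if s j then p11 else p01)) i (G ω)
        (fun b => if b then 1 else 0) (hG ω) (sum_stateProb _), sum_stateProb_mul]
      simp [H]
    have hr : ∀ ω s, ∑ s', (∏ j, stateProb (if s j then p11 else p01) (s' j)) *
        (G ω s' * ω i) = ω i * H ω s := by
      intro ω s
      simp only [H, Finset.mul_sum]
      exact Finset.sum_congr rfl fun s' _ => by ring
    simp only [hl, hr, hΨ]
    let G' : (Fin N → ℝ) → (Fin N → Bool) → ℝ := fun ω s =>
      if i ∈ π.1 t ω then 0 else (p11 - p01) * H (Ψ ω s) s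
    have hG' : ∀ ω s b, G' ω (Function.update s i b) = G' ω s := by
      intro ω s b
      simp only [G']
      split_ifs with hi
      · rfl
      · have : Ψ ω (Function.update s i b) = Ψ ω s := by
          ext j
          simp only [Ψ]
          by_cases hj : j = i
          · subst hj; simp [hi]
          · simp [hj]
        rw [this, hH]
    let F : (Fin N → ℝ) → (Fin N → Bool) → ℝ := fun ω s =>
      (if i ∈ π.1 t ω then (if s i then p11 else p01) else p01) * H (Ψ ω s) s
    have e1 : ∀ ω s, (if s i then p11 else p01) * H (Ψ ω s) s =
        F ω s + G' ω s * (if s i then 1 else 0) := by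
      intro ω s
      simp only [F, G']
      split_ifs <;> ring
    have e2 : ∀ ω s, Ψ ω s i * H (Ψ ω s) s = F ω s + G' ω s * ω i := by
      intro ω s
      simp only [F, G', Ψ, beliefStep]
      split_ifs <;> ring
    simp only [e1, e2]
    rw [integral_add (hS.integrable_belief_state t F)
        (hS.integrable_belief_state t fun ω s => G' ω s * if s i then 1 else 0),
      integral_add (hS.integrable_belief_state t F)
        (hS.integrable_belief_state t fun ω s => G' ω s * ω i), ih i G' hG']

/-- The expected reward of a slot is the expected total belief of the sensed channels. -/
theorem IsChannelSystem.integral_slotReward (hS : IsChannelSystem P p01 p11 ω₁ S) (t : ℕ) :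
    ∫ w, slotReward p01 p11 ω₁ π (fun r => S r w) t ∂P =
      ∫ w, ∑ i ∈ π.1 t (beliefVec p01 p11 ω₁ π (fun r => S r w) t),
        beliefVec p01 p11 ω₁ π (fun r => S r w) t i ∂P := by
  have e1 : ∀ w, slotReward p01 p11 ω₁ π (fun r => S r w) t =
      ∑ i, (if i ∈ π.1 t (beliefVec p01 p11 ω₁ π (fun r => S r w) t) then 1 else 0) *
        if S t w i then 1 else 0 := fun w => by
    simp only [slotReward, ite_mul, one_mul, zero_mul, Finset.sum_ite_mem, Finset.univ_inter]
  have e2 : ∀ w, ∑ i ∈ π.1 t (beliefVec p01 p11 ω₁ π (fun r => S r w) t),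
        beliefVec p01 p11 ω₁ π (fun r => S r w) t i =
      ∑ i, (if i ∈ π.1 t (beliefVec p01 p11 ω₁ π (fun r => S r w) t) then 1 else 0) *
        beliefVec p01 p11 ω₁ π (fun r => S r w) t i := fun w => by
    simp only [ite_mul, one_mul, zero_mul, Finset.sum_ite_mem, Finset.univ_inter]
  simp only [e1, e2]
  rw [integral_finsetSum _ fun i _ => hS.integrable_belief_state t
      fun ω s => (if i ∈ π.1 t ω then 1 else 0) * if s i then 1 else 0,
    integral_finsetSum _ fun i _ => hS.integrable_belief_state t
      fun ω _ => (if i ∈ π.1 t ω then 1 else 0) * ω i]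
  exact Finset.sum_congr rfl fun i _ =>
    hS.integral_mul_state t i (fun ω _ => if i ∈ π.1 t ω then 1 else 0) fun _ _ _ => rfl

end Channels
section Averages

variable {a φ : ℕ → ℝ} {B C M : ℝ}

theorem average_mem_Icc (ha : ∀ t, a t ∈ Set.Icc 0 M) (hM : 0 ≤ M) (T : ℕ) :
    1 / (T : ℝ) * ∑ t ∈ Finset.range T, a t ∈ Set.Icc 0 M := by
  have h0 : 0 ≤ ∑ t ∈ Finset.range T, a t := Finset.sum_nonneg fun t _ => (ha t).1
  have h1 : ∑ t ∈ Finset.range T, a t ≤ T * M := by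
    simpa using Finset.sum_le_card_nsmul (Finset.range T) a M fun t _ => (ha t).2
  refine ⟨by positivity, ?_⟩
  rw [one_div_mul_eq_div]
  exact div_le_of_le_mul₀ (by positivity) hM (by linarith)

theorem tendsto_const_add_div (C D : ℝ) :
    Tendsto (fun T : ℕ => C + D / (T : ℝ)) atTop (𝓝 C) := by
  simpa using tendsto_const_nhds.add (tendsto_const_div_atTop_nhds_zero_nat D)

theorem limsup_average_le (ha : ∀ t, a t ∈ Set.Icc 0 M) (hM : 0 ≤ M) (hφ : ∀ t, |φ t| ≤ B)
    (h : ∀ t, a t + φ (t + 1) ≤ C + φ t) :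
    limsup (fun T : ℕ => 1 / (T : ℝ) * ∑ t ∈ Finset.range T, a t) atTop ≤ C := by
  have hsum : ∀ T : ℕ, ∑ t ∈ Finset.range T, a t + φ T ≤ C * T + φ 0 := by
    intro T
    induction T with
    | zero => simp
    | succ T ih =>
      rw [Finset.sum_range_succ]
      push_cast
      linarith [h T]
  rw [← (tendsto_const_add_div C (2 * B)).limsup_eq]
  refine limsup_le_limsup ?_ ?_ (tendsto_const_add_div C (2 * B)).isBoundedUnder_le
  · filter_upwards [eventually_gt_atTop 0] with T hT
    have hT' : (0 : ℝ) < T := Nat.cast_pos.2 hT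
    rw [one_div_mul_eq_div, div_le_iff₀ hT', add_mul, div_mul_cancel₀ _ hT'.ne']
    linarith [hsum T, (abs_le.1 (hφ 0)).2, (abs_le.1 (hφ T)).1]
  · exact (isBoundedUnder_of ⟨0, fun T => (average_mem_Icc ha hM T).1⟩ :
      IsBoundedUnder (· ≥ ·) atTop _).isCoboundedUnder_le

theorem le_liminf_average (ha : ∀ t, a t ∈ Set.Icc 0 M) (hM : 0 ≤ M) (hφ : ∀ t, |φ t| ≤ B)
    (t₀ : ℕ) (h : ∀ t, t₀ ≤ t → C + φ t ≤ a t + φ (t + 1)) :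
    C ≤ liminf (fun T : ℕ => 1 / (T : ℝ) * ∑ t ∈ Finset.range T, a t) atTop := by
  have hsum : ∀ T : ℕ, t₀ ≤ T → C * (T - t₀) + φ t₀ ≤ ∑ t ∈ Finset.range T, a t + φ T := by
    intro T hT
    induction T, hT using Nat.le_induction with
    | base =>
      have : 0 ≤ ∑ t ∈ Finset.range t₀, a t := Finset.sum_nonneg fun t _ => (ha t).1
      linarith
    | succ T hT ih =>
      rw [Finset.sum_range_succ]
      push_cast
      linarith [h T hT]
  rw [← (tendsto_const_add_div C (-(C * t₀ + 2 * B))).liminf_eq]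
  refine liminf_le_liminf ?_ (tendsto_const_add_div C _).isBoundedUnder_ge ?_
  · filter_upwards [eventually_gt_atTop 0, eventually_ge_atTop t₀] with T hT hT₀
    have hT' : (0 : ℝ) < T := Nat.cast_pos.2 hT
    rw [one_div_mul_eq_div, le_div_iff₀ hT', add_mul, div_mul_cancel₀ _ hT'.ne']
    linarith [hsum T hT₀, (abs_le.1 (hφ t₀)).1, (abs_le.1 (hφ T)).2]
  · exact (isBoundedUnder_of ⟨M, fun T => (average_mem_Icc ha hM T).2⟩ :
      IsBoundedUnder (· ≤ ·) atTop _).isCoboundedUnder_ge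

end Averages

section LargestElements

variable {ι : Type*} [DecidableEq ι]

theorem sum_le_sum_of_largest {U A : Finset ι} {f : ι → ℝ} (hU : ∀ i ∈ U, ∀ j ∉ U, f j ≤ f i)
    (hA : A.card = U.card) : ∑ i ∈ A, f i ≤ ∑ i ∈ U, f i := by
  have hc : (A \ U).card = (U \ A).card := by
    have h1 := Finset.card_sdiff_add_card_inter A U
    have h2 := Finset.card_sdiff_add_card_inter U A
    rw [Finset.inter_comm] at h2
    omega
  suffices h : ∑ i ∈ A \ U, f i ≤ ∑ i ∈ U \ A, f i by
    rw [← Finset.sum_inter_add_sum_sdiff A U f, ← Finset.sum_inter_add_sum_sdiff U A f,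
      Finset.inter_comm U A]
    linarith
  rcases (A \ U).eq_empty_or_nonempty with he | hne
  · rw [he, Finset.card_empty] at hc
    rw [he, Finset.card_eq_zero.1 hc.symm]
  · obtain ⟨j, hj, hmax⟩ := Finset.exists_max_image _ f hne
    have h1 := Finset.sum_le_card_nsmul _ f _ hmax
    have h2 := Finset.card_nsmul_le_sum (U \ A) f (f j) fun i hi =>
      hU i (Finset.mem_sdiff.1 hi).1 j (Finset.mem_sdiff.1 hj).2
    rw [hc] at h1
    exact h1.trans h2

theorem le_sum_of_largest {U D G : Finset ι} {f : ι → ℝ} {x b : ℝ}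
    (hU : ∀ i ∈ U, ∀ j ∉ U, f j ≤ f i) (hD : ∀ i ∈ D, b ≤ f i) (hUD : U.card ≤ D.card)
    (hGD : G ⊆ D) (hGU : G.card ≤ U.card) (hG : ∀ i ∈ G, f i = x) :
    G.card * x + (U.card - G.card) * b ≤ ∑ i ∈ U, f i := by
  obtain ⟨A, hGA, hAD, hA⟩ := Finset.exists_subsuperset_card_eq hGD hGU hUD
  refine le_trans ?_ (sum_le_sum_of_largest hU hA)
  rw [← Finset.sum_sdiff hGA, Finset.sum_congr rfl hG, Finset.sum_const, nsmul_eq_mul]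
  have h1 := Finset.card_nsmul_le_sum (A \ G) f b fun i hi =>
    hD i (hAD (Finset.mem_sdiff.1 hi).1)
  rw [Finset.card_sdiff_of_subset hGA, hA, nsmul_eq_mul, Nat.cast_sub hGU] at h1
  linarith

end LargestElements

section Throughput

variable {X : Type*} [MeasurableSpace X] {P : Measure X} [IsProbabilityMeasure P]
  {N K : ℕ} {p01 p11 : ℝ} {ω₁ : Fin N → ℝ} {S : ℕ → X → Fin N → Bool} {π : Policy N K}

theorem sum_const_sensed (t : ℕ) (ω : Fin N → ℝ) (c : ℝ) : ∑ _i ∈ π.1 t ω, c = K * c := by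
  rw [Finset.sum_const, π.2, nsmul_eq_mul]

theorem slotReward_mem_Icc (s : ℕ → Fin N → Bool) (t : ℕ) :
    slotReward p01 p11 ω₁ π s t ∈ Set.Icc (0 : ℝ) K := by
  unfold slotReward
  constructor
  · exact Finset.sum_nonneg fun i _ => by split_ifs <;> norm_num
  · have h := Finset.sum_le_card_nsmul (π.1 t (beliefVec p01 p11 ω₁ π s t))
      (fun i => if s t i then (1 : ℝ) else 0) 1 fun i _ => by split_ifs <;> norm_num
    simpa [π.2] using h

theorem IsChannelSystem.integrable_slotReward (hS : IsChannelSystem P p01 p11 ω₁ S) (t : ℕ) :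
    Integrable (fun w => slotReward p01 p11 ω₁ π (fun r => S r w) t) P :=
  hS.integrable_belief_state t fun ω s => ∑ i ∈ π.1 t ω, if s i then 1 else 0

theorem IsChannelSystem.integral_slotReward_mem_Icc (hS : IsChannelSystem P p01 p11 ω₁ S)
    (t : ℕ) : ∫ w, slotReward p01 p11 ω₁ π (fun r => S r w) t ∂P ∈ Set.Icc (0 : ℝ) K := by
  refine ⟨integral_nonneg fun w => (slotReward_mem_Icc _ t).1, ?_⟩
  simpa using integral_mono (hS.integrable_slotReward t) (integrable_const (K : ℝ)) fun w =>
    (slotReward_mem_Icc (π := π) (fun r => S r w) t).2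

theorem IsChannelSystem.meanReward_eq (hS : IsChannelSystem P p01 p11 ω₁ S) :
    meanReward P p01 p11 ω₁ S π = fun T : ℕ => 1 / (T : ℝ) * ∑ t ∈ Finset.range T,
      ∫ w, slotReward p01 p11 ω₁ π (fun r => S r w) t ∂P := by
  ext T
  rw [meanReward, integral_const_mul, integral_finsetSum _ fun t _ => hS.integrable_slotReward t]

theorem IsChannelSystem.meanReward_mem_Icc (hS : IsChannelSystem P p01 p11 ω₁ S) (T : ℕ) :
    meanReward P p01 p11 ω₁ S π T ∈ Set.Icc (0 : ℝ) K := by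
  rw [hS.meanReward_eq]
  exact average_mem_Icc hS.integral_slotReward_mem_Icc (Nat.cast_nonneg K) T

theorem IsChannelSystem.lowerThroughput_le_upperThroughput
    (hS : IsChannelSystem P p01 p11 ω₁ S) :
    lowerThroughput P p01 p11 ω₁ S π ≤ upperThroughput P p01 p11 ω₁ S π :=
  liminf_le_limsup (isBoundedUnder_of ⟨(K : ℝ), fun T => (hS.meanReward_mem_Icc T).2⟩)
    (isBoundedUnder_of ⟨0, fun T => (hS.meanReward_mem_Icc T).1⟩)

theorem IsChannelSystem.optimal_bounds (hS : IsChannelSystem P p01 p11 ω₁ S) {lb ub : ℝ}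
    (hlb : lb ≤ lowerThroughput P p01 p11 ω₁ S π)
    (hub : ∀ σ : Policy N K, upperThroughput P p01 p11 ω₁ S σ ≤ ub) :
    (lb ≤ lowerThroughput P p01 p11 ω₁ S π ∧
      lowerThroughput P p01 p11 ω₁ S π ≤ lowerOptimal P K p01 p11 ω₁ S ∧
      lowerOptimal P K p01 p11 ω₁ S ≤ ub) ∧
    (lb ≤ upperThroughput P p01 p11 ω₁ S π ∧
      upperThroughput P p01 p11 ω₁ S π ≤ upperOptimal P K p01 p11 ω₁ S ∧
      upperOptimal P K p01 p11 ω₁ S ≤ ub) := by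
  have : Nonempty (Policy N K) := ⟨π⟩
  have hub' : ∀ σ : Policy N K, lowerThroughput P p01 p11 ω₁ S σ ≤ ub := fun σ =>
    hS.lowerThroughput_le_upperThroughput.trans (hub σ)
  exact ⟨⟨hlb, le_ciSup (f := fun σ : Policy N K => lowerThroughput P p01 p11 ω₁ S σ)
      ⟨ub, Set.forall_mem_range.2 hub'⟩ π, ciSup_le hub'⟩,
    hlb.trans hS.lowerThroughput_le_upperThroughput,
    le_ciSup (f := fun σ : Policy N K => upperThroughput P p01 p11 ω₁ S σ)
      ⟨ub, Set.forall_mem_range.2 hub⟩ π, ciSup_le hub⟩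

/-- An upper bound on the throughput of all policies from a potential function of the
single-armed bandit process with subsidy `m`, where `g` bounds its average reward. -/
theorem IsChannelSystem.upperThroughput_le (hS : IsChannelSystem P p01 p11 ω₁ S)
    (h01 : p01 ∈ Set.Icc (0 : ℝ) 1) (h11 : p11 ∈ Set.Icc (0 : ℝ) 1)
    (hω₁ : ∀ i, ω₁ i ∈ Set.Icc (0 : ℝ) 1) {h : ℝ → ℝ} {B g m : ℝ}
    (hB : ∀ x ∈ Set.Icc (0 : ℝ) 1, |h x| ≤ B)
    (hpassive : ∀ x ∈ Set.Icc (0 : ℝ) 1, m + h (beliefStep p01 p11 x) ≤ g + h x)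
    (hactive : ∀ x ∈ Set.Icc (0 : ℝ) 1, x + (x * h p11 + (1 - x) * h p01) ≤ g + h x) :
    upperThroughput P p01 p11 ω₁ S π ≤ N * g - m * (N - K) := by
  have hI : ∀ t (F : (Fin N → ℝ) → ℝ), Integrable
      (fun w => F (beliefVec p01 p11 ω₁ π (fun r => S r w) t)) P := fun t F =>
    hS.integrable_belief_state t fun ω _ => F ω
  have hmem := beliefVec_mem_Icc (π := π) h01 h11 hω₁
  have hΦ : ∀ t, |∫ w, ∑ i, h (beliefVec p01 p11 ω₁ π (fun r => S r w) t i) ∂P| ≤ N * B := by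
    intro t
    have hn := norm_integral_le_of_norm_le_const (μ := P) (C := N * B)
      (f := fun w => ∑ i, h (beliefVec p01 p11 ω₁ π (fun r => S r w) t i))
      (Eventually.of_forall fun w => by
        refine (norm_sum_le _ _).trans ?_
        simpa using Finset.sum_le_card_nsmul Finset.univ _ B fun i _ =>
          hB _ (hmem (fun r => S r w) t i))
    simpa using hn
  rw [upperThroughput, hS.meanReward_eq]
  refine limsup_average_le hS.integral_slotReward_mem_Icc (Nat.cast_nonneg K) hΦ fun t => ?_
  let F : (Fin N → ℝ) → ℝ := fun ω => K * h p01 + ∑ i ∈ (π.1 t ω)ᶜ, h (beliefStep p01 p11 (ω i))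
  have hstep : ∀ s, slotReward p01 p11 ω₁ π s t + ∑ i, h (beliefVec p01 p11 ω₁ π s (t + 1) i) =
      (1 + h p11 - h p01) * slotReward p01 p11 ω₁ π s t + F (beliefVec p01 p11 ω₁ π s t) := by
    intro s
    rw [← Finset.sum_add_sum_compl (π.1 t (beliefVec p01 p11 ω₁ π s t))]
    have e1 : ∑ i ∈ π.1 t (beliefVec p01 p11 ω₁ π s t), h (beliefVec p01 p11 ω₁ π s (t + 1) i) =
        K * h p01 + (h p11 - h p01) * slotReward p01 p11 ω₁ π s t := by
      rw [slotReward, Finset.mul_sum, ← sum_const_sensed, ← Finset.sum_add_distrib]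
      refine Finset.sum_congr rfl fun i hi => ?_
      simp only [beliefVec, if_pos hi]
      split_ifs <;> ring
    have e2 : ∑ i ∈ (π.1 t (beliefVec p01 p11 ω₁ π s t))ᶜ,
        h (beliefVec p01 p11 ω₁ π s (t + 1) i) =
        ∑ i ∈ (π.1 t (beliefVec p01 p11 ω₁ π s t))ᶜ,
          h (beliefStep p01 p11 (beliefVec p01 p11 ω₁ π s t i)) :=
      Finset.sum_congr rfl fun i hi => by
        simp only [beliefVec, if_neg (Finset.mem_compl.1 hi)]
    rw [e1, e2]
    ring
  have hdrift : ∀ ω : Fin N → ℝ, (∀ i, ω i ∈ Set.Icc (0 : ℝ) 1) →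
      (1 + h p11 - h p01) * ∑ i ∈ π.1 t ω, ω i + F ω ≤ N * g - m * (N - K) + ∑ i, h (ω i) := by
    intro ω hω
    have e1 := Finset.sum_le_sum fun i (_ : i ∈ π.1 t ω) => hactive (ω i) (hω i)
    have e2 := Finset.sum_le_sum fun i (_ : i ∈ (π.1 t ω)ᶜ) => hpassive (ω i) (hω i)
    have e3 : ∑ i ∈ π.1 t ω, (ω i + (ω i * h p11 + (1 - ω i) * h p01)) =
        (1 + h p11 - h p01) * ∑ i ∈ π.1 t ω, ω i + K * h p01 := by
      rw [← sum_const_sensed (π := π) t ω, Finset.mul_sum, ← Finset.sum_add_distrib]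
      exact Finset.sum_congr rfl fun i _ => by ring
    have hKN : K ≤ N := by
      simpa [π.2] using Finset.card_le_univ (π.1 t ω)
    rw [e3, Finset.sum_add_distrib, Finset.sum_const, π.2, nsmul_eq_mul] at e1
    rw [Finset.sum_add_distrib, Finset.sum_add_distrib, Finset.sum_const, Finset.sum_const,
      Finset.card_compl, π.2, Fintype.card_fin, nsmul_eq_mul, nsmul_eq_mul, Nat.cast_sub hKN] at e2
    rw [← Finset.sum_add_sum_compl (π.1 t ω) fun i => h (ω i)]
    simp only [F]
    linarith
  rw [← integral_add (hS.integrable_slotReward t) (hI (t + 1) fun ω => ∑ i, h (ω i))]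
  simp only [hstep]
  rw [integral_add ((hS.integrable_slotReward t).const_mul _) (hI t F), integral_const_mul,
    hS.integral_slotReward, ← integral_const_mul,
    ← integral_add ((hI t fun ω => ∑ i ∈ π.1 t ω, ω i).const_mul _) (hI t F)]
  refine (integral_mono (((hI t fun ω => ∑ i ∈ π.1 t ω, ω i).const_mul _).add (hI t F))
    ((integrable_const (N * g - m * (N - K))).add (hI t fun ω => ∑ i, h (ω i)))
    fun w => hdrift _ (hmem _ t)).trans (le_of_eq ?_)
  rw [integral_add' (integrable_const _) (hI t fun ω => ∑ i, h (ω i))]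
  simp

/-- A lower bound on the throughput of a policy whose expected reward, given the present one,
is bounded below by an affine function of it. -/
theorem IsChannelSystem.le_lowerThroughput (hS : IsChannelSystem P p01 p11 ω₁ S) {α δ : ℝ}
    (hδ : δ < 1) (t₀ : ℕ)
    (h : ∀ t, t₀ ≤ t → ∀ s, α + δ * slotReward p01 p11 ω₁ π s t ≤
      ∑ i ∈ π.1 (t + 1) (beliefVec p01 p11 ω₁ π s (t + 1)), beliefVec p01 p11 ω₁ π s (t + 1) i) :
    α / (1 - δ) ≤ lowerThroughput P p01 p11 ω₁ S π := by
  have hδ' : 0 < 1 - δ := sub_pos.2 hδ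
  rw [lowerThroughput, hS.meanReward_eq]
  refine le_liminf_average (M := K) (B := K / (1 - δ))
    (φ := fun t => (∫ w, slotReward p01 p11 ω₁ π (fun r => S r w) t ∂P) / (1 - δ))
    hS.integral_slotReward_mem_Icc (Nat.cast_nonneg K) (fun t => ?_) t₀ fun t ht => ?_
  · have := hS.integral_slotReward_mem_Icc (π := π) t
    rw [abs_of_nonneg (div_nonneg this.1 hδ'.le)]
    exact div_le_div_of_nonneg_right this.2 hδ'.le
  · have hm := integral_mono
      ((integrable_const α).add ((hS.integrable_slotReward (π := π) t).const_mul δ))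
      (hS.integrable_belief_state (t + 1) fun ω _ => ∑ i ∈ π.1 (t + 1) ω, ω i)
      fun w => h t ht fun r => S r w
    rw [← hS.integral_slotReward, integral_add' (integrable_const _)
      ((hS.integrable_slotReward t).const_mul δ), integral_const_mul] at hm
    simp only [integral_const, probReal_univ, one_smul] at hm
    rw [← add_div, div_le_iff₀ hδ', add_mul, div_mul_cancel₀ _ hδ'.ne']
    linarith

end Throughput

section BeliefStep

variable {p01 p11 : ℝ}

theorem stationaryBelief_spec (h01 : 0 < p01) (h11 : p11 < 1) :
    stationaryBelief p01 p11 * (p01 + (1 - p11)) = p01 :=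
  div_mul_cancel₀ _ (by linarith)

theorem stationaryBelief_pos (h01 : 0 < p01) (h11 : p11 < 1) : 0 < stationaryBelief p01 p11 :=
  div_pos h01 (by linarith)

theorem beliefStep_sub (p01 p11 x y : ℝ) :
    beliefStep p01 p11 x - beliefStep p01 p11 y = (p11 - p01) * (x - y) := by
  unfold beliefStep
  ring

theorem beliefStep_mem_Icc_of_le (h : p01 ≤ p11) {x : ℝ} (hx : x ∈ Set.Icc (0 : ℝ) 1) :
    beliefStep p01 p11 x ∈ Set.Icc p01 p11 := by
  unfold beliefStep
  constructor <;> nlinarith [hx.1, hx.2]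

theorem beliefStep_mem_Icc_of_ge (h : p11 ≤ p01) {x : ℝ} (hx : x ∈ Set.Icc (0 : ℝ) 1) :
    beliefStep p01 p11 x ∈ Set.Icc p11 p01 := by
  unfold beliefStep
  constructor <;> nlinarith [hx.1, hx.2]

theorem iterate_beliefStep_mem_Icc_of_le (h0 : 0 ≤ p01) (h1 : p11 ≤ 1) (h : p01 ≤ p11) {x : ℝ}
    (hx : x ∈ Set.Icc p01 p11) (k : ℕ) : (beliefStep p01 p11)^[k] x ∈ Set.Icc p01 p11 := by
  induction k with
  | zero => exact hx
  | succ k ih =>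
    rw [Function.iterate_succ_apply']
    exact beliefStep_mem_Icc_of_le h ⟨h0.trans ih.1, ih.2.trans h1⟩

theorem iterate_beliefStep_mem_Icc_of_ge (h0 : 0 ≤ p11) (h1 : p01 ≤ 1) (h : p11 ≤ p01) {x : ℝ}
    (hx : x ∈ Set.Icc p11 p01) (k : ℕ) : (beliefStep p01 p11)^[k] x ∈ Set.Icc p11 p01 := by
  induction k with
  | zero => exact hx
  | succ k ih =>
    rw [Function.iterate_succ_apply']
    exact beliefStep_mem_Icc_of_ge h ⟨h0.trans ih.1, ih.2.trans h1⟩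

theorem lt_of_beliefStep_lt_of_le (h : p01 ≤ p11) {x y : ℝ}
    (hxy : beliefStep p01 p11 x < beliefStep p01 p11 y) : x < y := by
  by_contra! hle
  have := beliefStep_sub p01 p11 x y
  nlinarith

theorem lt_of_beliefStep_lt_of_ge (h : p11 ≤ p01) {x y : ℝ}
    (hxy : beliefStep p01 p11 x < beliefStep p01 p11 y) : y < x := by
  by_contra! hle
  have := beliefStep_sub p01 p11 x y
  nlinarith

end BeliefStep

section LowBeliefs

variable {N K : ℕ} {p01 p11 : ℝ} {ω₁ : Fin N → ℝ} {π : Policy N K}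

theorem beliefVec_succ_of_notMem {s : ℕ → Fin N → Bool} {t : ℕ} {i : Fin N}
    (hi : i ∉ π.1 t (beliefVec p01 p11 ω₁ π s t)) :
    beliefVec p01 p11 ω₁ π s (t + 1) i = beliefStep p01 p11 (beliefVec p01 p11 ω₁ π s t i) := by
  simp only [beliefVec, if_neg hi]

theorem beliefVec_succ_mem_Icc_of_le (h0 : 0 ≤ p01) (h1 : p11 ≤ 1) (h : p01 ≤ p11)
    (hω₁ : ∀ i, ω₁ i ∈ Set.Icc (0 : ℝ) 1) (s : ℕ → Fin N → Bool) (t : ℕ) (i : Fin N) :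
    beliefVec p01 p11 ω₁ π s (t + 1) i ∈ Set.Icc p01 p11 := by
  have hm := beliefVec_mem_Icc (π := π) ⟨h0, h.trans h1⟩ ⟨h0.trans h, h1⟩ hω₁ s t i
  simp only [beliefVec]
  split_ifs
  · exact ⟨h, le_rfl⟩
  · exact ⟨le_rfl, h⟩
  · exact beliefStep_mem_Icc_of_le h hm

theorem beliefVec_succ_mem_Icc_of_ge (h0 : 0 ≤ p11) (h1 : p01 ≤ 1) (h : p11 ≤ p01)
    (hω₁ : ∀ i, ω₁ i ∈ Set.Icc (0 : ℝ) 1) (s : ℕ → Fin N → Bool) (t : ℕ) (i : Fin N) :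
    beliefVec p01 p11 ω₁ π s (t + 1) i ∈ Set.Icc p11 p01 := by
  have hm := beliefVec_mem_Icc (π := π) ⟨h0.trans h, h1⟩ ⟨h0, h.trans h1⟩ hω₁ s t i
  simp only [beliefVec]
  split_ifs
  · exact ⟨le_rfl, h⟩
  · exact ⟨h, le_rfl⟩
  · exact beliefStep_mem_Icc_of_ge h hm

/-- For positively correlated channels, at most `k * K` channels have a belief below that of a
channel that was bad when last sensed, `k + 1` slots ago. -/
theorem card_beliefVec_lt_of_le (h0 : 0 ≤ p01) (h1 : p11 ≤ 1) (h : p01 ≤ p11)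
    (hω₁ : ∀ i, ω₁ i ∈ Set.Icc (0 : ℝ) 1) (s : ℕ → Fin N → Bool) (k : ℕ) :
    ∀ t, k + 1 ≤ t → (Finset.univ.filter fun i =>
      beliefVec p01 p11 ω₁ π s t i < (beliefStep p01 p11)^[k] p01).card ≤ k * K := by
  induction k with
  | zero =>
    intro t ht
    obtain ⟨t, rfl⟩ : ∃ r, t = r + 1 := Nat.exists_eq_add_of_le' ht
    refine (Finset.card_eq_zero.2 (Finset.filter_false_of_mem fun i _ => ?_)).le.trans
      (Nat.zero_le _)
    exact not_lt.2 (beliefVec_succ_mem_Icc_of_le h0 h1 h hω₁ s t i).1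
  | succ k ih =>
    intro t ht
    obtain ⟨t, rfl⟩ := Nat.exists_eq_add_of_le' (Nat.le_of_add_left_le ht)
    have hsub : (Finset.univ.filter fun i =>
        beliefVec p01 p11 ω₁ π s (t + 1) i < (beliefStep p01 p11)^[k + 1] p01) ⊆
        (Finset.univ.filter fun i =>
          beliefVec p01 p11 ω₁ π s t i < (beliefStep p01 p11)^[k] p01) ∪
        π.1 t (beliefVec p01 p11 ω₁ π s t) := by
      intro i hi
      rw [Finset.mem_filter, Function.iterate_succ_apply'] at hi
      by_cases hU : i ∈ π.1 t (beliefVec p01 p11 ω₁ π s t)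
      · exact Finset.mem_union_right _ hU
      · simp only [beliefVec, if_neg hU] at hi
        exact Finset.mem_union_left _
          (Finset.mem_filter.2 ⟨Finset.mem_univ i, lt_of_beliefStep_lt_of_le h hi.2⟩)
    calc _ ≤ _ := Finset.card_le_card hsub
      _ ≤ _ := Finset.card_union_le _ _
      _ ≤ k * K + K := by rw [π.2]; exact Nat.add_le_add_right (ih t (by omega)) K
      _ = (k + 1) * K := by ring

/-- For negatively correlated channels under the myopic policy, at most `k * K` channels have a
belief below that of a channel that was good when last sensed, `2 * k + 1` slots ago. -/
theorem card_beliefVec_lt_of_ge (h0 : 0 ≤ p11) (h1 : p01 ≤ 1) (h : p11 ≤ p01)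
    (hω₁ : ∀ i, ω₁ i ∈ Set.Icc (0 : ℝ) 1) (s : ℕ → Fin N → Bool)
    (hπ : ∀ t, ∀ i ∈ π.1 t (beliefVec p01 p11 ω₁ π s t),
      ∀ j ∉ π.1 t (beliefVec p01 p11 ω₁ π s t),
        beliefVec p01 p11 ω₁ π s t j ≤ beliefVec p01 p11 ω₁ π s t i) (k : ℕ) :
    ∀ t, 2 * k + 1 ≤ t → (Finset.univ.filter fun i =>
      beliefVec p01 p11 ω₁ π s t i < (beliefStep p01 p11)^[2 * k] p11).card ≤ k * K := by
  induction k with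
  | zero =>
    intro t ht
    obtain ⟨t, rfl⟩ : ∃ r, t = r + 1 := Nat.exists_eq_add_of_le' ht
    refine (Finset.card_eq_zero.2 (Finset.filter_false_of_mem fun i _ => ?_)).le.trans
      (Nat.zero_le _)
    exact not_lt.2 (beliefVec_succ_mem_Icc_of_ge h0 h1 h hω₁ s t i).1
  | succ k ih =>
    intro t ht
    obtain ⟨t, rfl⟩ : ∃ r, t = r + 2 := Nat.exists_eq_add_of_le' (by omega)
    have hhigh : (Finset.univ.filter fun i => (beliefStep p01 p11)^[2 * k + 1] p11 <
        beliefVec p01 p11 ω₁ π s (t + 1) i).card ≤ (k + 1) * K := by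
      have hsub : (Finset.univ.filter fun i => (beliefStep p01 p11)^[2 * k + 1] p11 <
          beliefVec p01 p11 ω₁ π s (t + 1) i) ⊆
          (Finset.univ.filter fun i =>
            beliefVec p01 p11 ω₁ π s t i < (beliefStep p01 p11)^[2 * k] p11) ∪
          π.1 t (beliefVec p01 p11 ω₁ π s t) := by
        intro i hi
        rw [Finset.mem_filter, Function.iterate_succ_apply'] at hi
        by_cases hU : i ∈ π.1 t (beliefVec p01 p11 ω₁ π s t)
        · exact Finset.mem_union_right _ hU
        · simp only [beliefVec, if_neg hU] at hi
          exact Finset.mem_union_left _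
            (Finset.mem_filter.2 ⟨Finset.mem_univ i, lt_of_beliefStep_lt_of_ge h hi.2⟩)
      calc _ ≤ _ := Finset.card_le_card hsub
        _ ≤ _ := Finset.card_union_le _ _
        _ ≤ k * K + K := by rw [π.2]; exact Nat.add_le_add_right (ih t (by omega)) K
        _ = (k + 1) * K := by ring
    have hunsensed : ∀ i, beliefVec p01 p11 ω₁ π s (t + 2) i <
        (beliefStep p01 p11)^[2 * (k + 1)] p11 →
        i ∉ π.1 (t + 1) (beliefVec p01 p11 ω₁ π s (t + 1)) →
        (beliefStep p01 p11)^[2 * k + 1] p11 < beliefVec p01 p11 ω₁ π s (t + 1) i := by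
      intro i hi hU
      rw [show 2 * (k + 1) = (2 * k + 1) + 1 by ring, Function.iterate_succ_apply'] at hi
      rw [beliefVec_succ_of_notMem hU] at hi
      exact lt_of_beliefStep_lt_of_ge h hi
    by_cases hj : ∃ j ∉ π.1 (t + 1) (beliefVec p01 p11 ω₁ π s (t + 1)),
        (beliefStep p01 p11)^[2 * k + 1] p11 < beliefVec p01 p11 ω₁ π s (t + 1) j
    · obtain ⟨j, hjU, hj⟩ := hj
      refine (Finset.card_le_card fun i hi => ?_).trans hhigh
      rw [Finset.mem_filter] at hi ⊢
      refine ⟨hi.1, ?_⟩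
      by_cases hU : i ∈ π.1 (t + 1) (beliefVec p01 p11 ω₁ π s (t + 1))
      · exact hj.trans_le (hπ (t + 1) i hU j hjU)
      · exact hunsensed i hi.2 hU
    · push Not at hj
      have hsub : (Finset.univ.filter fun i => beliefVec p01 p11 ω₁ π s (t + 2) i <
          (beliefStep p01 p11)^[2 * (k + 1)] p11) ⊆
          π.1 (t + 1) (beliefVec p01 p11 ω₁ π s (t + 1)) := by
        intro i hi
        by_contra hU
        exact absurd (hunsensed i (Finset.mem_filter.1 hi).2 hU) (not_lt.2 (hj i hU))
      refine (Finset.card_le_card hsub).trans ?_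
      rw [π.2]
      exact Nat.le_mul_of_pos_left K k.succ_pos

theorem le_card_filter_le {f : Fin N → ℝ} {b : ℝ} (hK : 1 ≤ K) (hKN : K ≤ N)
    (h : (Finset.univ.filter fun i => f i < b).card ≤ (N / K - 1) * K) :
    K ≤ (Finset.univ.filter fun i => b ≤ f i).card := by
  have h1 := Finset.card_filter_add_card_filter_not (s := (Finset.univ : Finset (Fin N)))
    fun i => f i < b
  simp only [not_lt, Finset.card_univ, Fintype.card_fin] at h1
  have h2 := Nat.div_mul_le_self N K
  have h3 : 1 ≤ N / K := (Nat.one_le_div_iff hK).2 hKN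
  have h4 : (N / K - 1) * K + K = N / K * K := by
    rw [← Nat.succ_mul, Nat.succ_eq_add_one, Nat.sub_add_cancel h3]
  omega

theorem slotReward_eq_card (s : ℕ → Fin N → Bool) (t : ℕ) :
    slotReward p01 p11 ω₁ π s t =
      ((π.1 t (beliefVec p01 p11 ω₁ π s t)).filter fun i => s t i = true).card := by
  rw [slotReward, Finset.sum_boole]

theorem slotReward_eq_sub_card (s : ℕ → Fin N → Bool) (t : ℕ) :
    slotReward p01 p11 ω₁ π s t =
      K - ((π.1 t (beliefVec p01 p11 ω₁ π s t)).filter fun i => ¬ s t i = true).card := by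
  have h := Finset.card_filter_add_card_filter_not (s := π.1 t (beliefVec p01 p11 ω₁ π s t))
    fun i => s t i = true
  rw [π.2] at h
  rw [slotReward_eq_card, eq_sub_iff_add_eq]
  exact_mod_cast h

end LowBeliefs

section WhittleLowerBound

variable {X : Type*} [MeasurableSpace X] {P : Measure X} [IsProbabilityMeasure P]
  {N K : ℕ} {p01 p11 : ℝ} {ω₁ : Fin N → ℝ} {S : ℕ → X → Fin N → Bool} {π : Policy N K}

theorem IsChannelSystem.le_lowerThroughput_whittle_of_le (hS : IsChannelSystem P p01 p11 ω₁ S)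
    (hK : 1 ≤ K) (hKN : K ≤ N) (h0 : 0 < p01) (h1 : p11 < 1) (h : p01 ≤ p11)
    (hω₁ : ∀ i, ω₁ i ∈ Set.Icc (0 : ℝ) 1) (hπ : IsWhittlePolicy p01 p11 π) :
    K * (beliefStep p01 p11)^[N / K - 1] p01 / (1 - p11 + (beliefStep p01 p11)^[N / K - 1] p01) ≤
      lowerThroughput P p01 p11 ω₁ S π := by
  have h01 : p01 ∈ Set.Icc (0 : ℝ) 1 := ⟨h0.le, h.trans h1.le⟩
  have h11 : p11 ∈ Set.Icc (0 : ℝ) 1 := ⟨h0.le.trans h, h1.le⟩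
  set b := (beliefStep p01 p11)^[N / K - 1] p01
  have hbm : b ∈ Set.Icc p01 p11 :=
    iterate_beliefStep_mem_Icc_of_le h0.le h1.le h ⟨le_rfl, h⟩ _
  rw [show 1 - p11 + b = 1 - (p11 - b) by ring]
  refine hS.le_lowerThroughput (by linarith [hbm.1]) (N / K - 1) fun t ht s => ?_
  have hcard := le_card_filter_le hK hKN
    (card_beliefVec_lt_of_le (π := π) h0.le h1.le h hω₁ s (N / K - 1) (t + 1) (by omega))
  have key := le_sum_of_largest (f := beliefVec p01 p11 ω₁ π s (t + 1)) (x := p11) (b := b)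
    (U := π.1 (t + 1) (beliefVec p01 p11 ω₁ π s (t + 1)))
    (G := (π.1 t (beliefVec p01 p11 ω₁ π s t)).filter fun i => s t i = true)
    (fun i hi j hj => hπ.belief_le h01 h11 (beliefVec_mem_Icc h01 h11 hω₁ s _) hi hj)
    (fun i hi => (Finset.mem_filter.1 hi).2) (by rw [π.2]; exact hcard)
    (fun i hi => by
      rw [Finset.mem_filter] at hi ⊢
      refine ⟨Finset.mem_univ i, ?_⟩
      simp only [beliefVec, if_pos hi.1, if_pos hi.2]
      exact hbm.2)
    ((Finset.card_filter_le _ _).trans (by rw [π.2, π.2]))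
    (fun i hi => by
      rw [Finset.mem_filter] at hi
      simp only [beliefVec, if_pos hi.1, if_pos hi.2])
  rw [← slotReward_eq_card, π.2] at key
  linarith

theorem IsChannelSystem.le_lowerThroughput_whittle_of_ge (hS : IsChannelSystem P p01 p11 ω₁ S)
    (hK : 1 ≤ K) (hKN : K ≤ N) (h0 : 0 ≤ p11) (h1 : p01 ≤ 1) (h : p11 < p01)
    (hω₁ : ∀ i, ω₁ i ∈ Set.Icc (0 : ℝ) 1) (hπ : IsWhittlePolicy p01 p11 π) :
    K * p01 / (1 - (beliefStep p01 p11)^[2 * (N / K) - 2] p11 + p01) ≤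
      lowerThroughput P p01 p11 ω₁ S π := by
  have h01 : p01 ∈ Set.Icc (0 : ℝ) 1 := ⟨h0.trans h.le, h1⟩
  have h11 : p11 ∈ Set.Icc (0 : ℝ) 1 := ⟨h0, h.le.trans h1⟩
  rw [show 2 * (N / K) - 2 = 2 * (N / K - 1) by omega]
  set c := (beliefStep p01 p11)^[2 * (N / K - 1)] p11
  have hcm : c ∈ Set.Icc p11 p01 :=
    iterate_beliefStep_mem_Icc_of_ge h0 h1 h.le ⟨le_rfl, h.le⟩ _
  rw [show 1 - c + p01 = 1 - (c - p01) by ring]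
  refine hS.le_lowerThroughput (by linarith [hcm.2]) (2 * (N / K - 1)) fun t ht s => ?_
  have hmyopic : ∀ t, ∀ i ∈ π.1 t (beliefVec p01 p11 ω₁ π s t),
      ∀ j ∉ π.1 t (beliefVec p01 p11 ω₁ π s t),
        beliefVec p01 p11 ω₁ π s t j ≤ beliefVec p01 p11 ω₁ π s t i := fun t i hi j hj =>
    hπ.belief_le h01 h11 (beliefVec_mem_Icc h01 h11 hω₁ s t) hi hj
  have hcard := le_card_filter_le hK hKN
    (card_beliefVec_lt_of_ge h0 h1 h.le hω₁ s hmyopic (N / K - 1) (t + 1) (by omega))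
  have key := le_sum_of_largest (f := beliefVec p01 p11 ω₁ π s (t + 1)) (x := p01) (b := c)
    (U := π.1 (t + 1) (beliefVec p01 p11 ω₁ π s (t + 1)))
    (G := (π.1 t (beliefVec p01 p11 ω₁ π s t)).filter fun i => ¬ s t i = true)
    (hmyopic (t + 1))
    (fun i hi => (Finset.mem_filter.1 hi).2) (by rw [π.2]; exact hcard)
    (fun i hi => by
      rw [Finset.mem_filter] at hi ⊢
      refine ⟨Finset.mem_univ i, ?_⟩
      simp only [beliefVec, if_pos hi.1, if_neg hi.2]
      exact hcm.2)
    ((Finset.card_filter_le _ _).trans (by rw [π.2, π.2]))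
    (fun i hi => by
      rw [Finset.mem_filter] at hi
      simp only [beliefVec, if_pos hi.1, if_neg hi.2])
  rw [π.2] at key
  rw [slotReward_eq_sub_card]
  linarith

end WhittleLowerBound

section UpperBounds

variable {X : Type*} [MeasurableSpace X] {P : Measure X} [IsProbabilityMeasure P]
  {N K : ℕ} {p01 p11 : ℝ} {ω₁ : Fin N → ℝ} {S : ℕ → X → Fin N → Bool}

theorem IsChannelSystem.upperThroughput_le_stationaryBelief_mul
    (hS : IsChannelSystem P p01 p11 ω₁ S) (h0 : 0 < p01) (h01' : p01 ≤ 1) (h11 : 0 ≤ p11)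
    (h1 : p11 < 1) (hω₁ : ∀ i, ω₁ i ∈ Set.Icc (0 : ℝ) 1) (π : Policy N K) :
    upperThroughput P p01 p11 ω₁ S π ≤ stationaryBelief p01 p11 * N := by
  have hd : 0 < p01 + (1 - p11) := by linarith
  have key : ∀ x, beliefStep p01 p11 x / (p01 + (1 - p11)) =
      stationaryBelief p01 p11 + x / (p01 + (1 - p11)) - x := fun x => by
    unfold beliefStep stationaryBelief
    field_simp
    ring
  have hb := hS.upperThroughput_le (π := π) (h := fun x => x / (p01 + (1 - p11)))
    (B := 1 / (p01 + (1 - p11))) (g := stationaryBelief p01 p11) (m := 0) ⟨h0.le, h01'⟩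
    ⟨h11, h1.le⟩ hω₁ (fun x hx => ?_) (fun x hx => ?_) fun x _ => ?_
  · linarith
  · rw [abs_of_nonneg (div_nonneg hx.1 hd.le)]
    exact div_le_div_of_nonneg_right hx.2 hd.le
  · rw [key]
    linarith [hx.1]
  · have := key x
    rw [beliefStep, add_div, mul_div_assoc, mul_div_assoc] at this
    linarith

theorem IsChannelSystem.upperThroughput_le_of_le (hS : IsChannelSystem P p01 p11 ω₁ S)
    (h0 : 0 < p01) (h1 : p11 < 1) (h : p01 ≤ p11) (hω₁ : ∀ i, ω₁ i ∈ Set.Icc (0 : ℝ) 1)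
    (π : Policy N K) :
    upperThroughput P p01 p11 ω₁ S π ≤
      K * stationaryBelief p01 p11 / (1 - p11 + stationaryBelief p01 p11) := by
  have hspec := stationaryBelief_spec h0 h1
  have hpos := stationaryBelief_pos h0 h1
  set o := stationaryBelief p01 p11
  have hd : 0 < 1 - p11 + o := by linarith
  set c := 1 / (1 - p11 + o)
  have hc : 0 < c := div_pos one_pos hd
  have hcd : c * (1 - p11 + o) = 1 := div_mul_cancel₀ _ hd.ne'
  have ho1 : o ≤ p11 := by nlinarith
  have ho0 : p01 ≤ o := by nlinarith
  have hT : ∀ x, beliefStep p01 p11 x - o = (p11 - p01) * (x - o) := fun x => by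
    unfold beliefStep
    linear_combination -hspec
  have e11 : max 0 (c * (p11 - o)) = c * (p11 - o) := max_eq_right (by nlinarith)
  have e01 : max 0 (c * (p01 - o)) = 0 := max_eq_left (by nlinarith)
  have hb := hS.upperThroughput_le (π := π) (h := fun x => max 0 (c * (x - o)))
    (B := c) (g := c * o) (m := c * o) ⟨h0.le, h.trans h1.le⟩
    ⟨h0.le.trans h, h1.le⟩ hω₁ (fun x hx => ?_) (fun x _ => ?_) fun x _ => ?_
  · refine hb.trans (le_of_eq ?_)
    rw [mul_div_assoc, div_eq_mul_one_div o]
    ring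
  · rw [abs_of_nonneg (le_max_left _ _)]
    exact max_le hc.le (by nlinarith [hx.2])
  · rw [hT]
    refine add_le_add le_rfl (max_le (le_max_left _ _) ?_)
    rcases le_total 0 (c * (x - o)) with hx | hx
    · exact le_max_of_le_right (by nlinarith)
    · exact le_max_of_le_left (by nlinarith)
  · simp only [e11, e01]
    have := le_max_right 0 (c * (x - o))
    linear_combination this - x * hcd

theorem IsChannelSystem.upperThroughput_le_of_ge (hS : IsChannelSystem P p01 p11 ω₁ S)
    (h0 : 0 ≤ p11) (h1 : p01 ≤ 1) (h : p11 < p01) (hω₁ : ∀ i, ω₁ i ∈ Set.Icc (0 : ℝ) 1)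
    (π : Policy N K) :
    upperThroughput P p01 p11 ω₁ S π ≤ K * p01 / (1 - beliefStep p01 p11 p11 + p01) := by
  have h01 : p01 ∈ Set.Icc (0 : ℝ) 1 := ⟨h0.trans h.le, h1⟩
  have h11 : p11 ∈ Set.Icc (0 : ℝ) 1 := ⟨h0, h.le.trans h1⟩
  have ha := beliefStep_mem_Icc_of_ge h.le h11
  have hT01 := beliefStep_mem_Icc_of_ge h.le h01
  set a := beliefStep p01 p11 p11
  have hd : 0 < 1 - a + p01 := by linarith [ha.2]
  set c := 1 / (1 - a + p01)
  have hc : 0 < c := div_pos one_pos hd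
  have hcd : c * (1 - a + p01) = 1 := div_mul_cancel₀ _ hd.ne'
  have e11 : max p11 a = a := max_eq_right ha.1
  have e01 : max p01 (beliefStep p01 p11 p01) = p01 := max_eq_left hT01.2
  have hb := hS.upperThroughput_le (π := π) (h := fun x => c * max x (beliefStep p01 p11 x))
    (B := c) (g := c * p01) (m := c * p01) h01 h11 hω₁ (fun x hx => ?_) (fun x _ => ?_)
    fun x _ => ?_
  · refine hb.trans (le_of_eq ?_)
    rw [mul_div_assoc, div_eq_mul_one_div p01]
    ring
  · have hTx := beliefStep_mem_Icc h01 h11 hx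
    rw [abs_of_nonneg (mul_nonneg hc.le (le_max_of_le_left hx.1))]
    exact mul_le_of_le_one_right hc.le (max_le hx.2 hTx.2)
  · refine add_le_add le_rfl (mul_le_mul_of_nonneg_left (max_le (le_max_right _ _) ?_) hc.le)
    have h2 := beliefStep_sub p01 p11 (beliefStep p01 p11 x) x
    rcases le_total x (beliefStep p01 p11 x) with hx | hx
    · exact le_max_of_le_right (by nlinarith)
    · exact le_max_of_le_left (by nlinarith)
  · simp only [e01]
    change x + (x * (c * max p11 a) + (1 - x) * (c * p01)) ≤ _
    rw [e11]
    have := mul_le_mul_of_nonneg_left (le_max_left x (beliefStep p01 p11 x)) hc.le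
    linear_combination this - x * hcd

end UpperBounds

theorem theorem5 {X : Type*} [MeasurableSpace X] (P : Measure X) [IsProbabilityMeasure P]
    (N K : ℕ) (hK : 1 ≤ K) (hKN : K ≤ N)
    (p01 p11 : ℝ) (h01 : 0 < p01) (h01' : p01 ≤ 1) (h11 : 0 ≤ p11) (h11' : p11 < 1)
    (ω₁ : Fin N → ℝ) (hω₁ : ∀ i, ω₁ i ∈ Set.Icc (0 : ℝ) 1)
    (S : ℕ → X → Fin N → Bool) (hS : IsChannelSystem P p01 p11 ω₁ S)
    (π : Policy N K) (hπ : IsWhittlePolicy p01 p11 π) :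
    (p01 ≤ p11 →
      ∀ lb ub : ℝ,
        lb = K * (beliefStep p01 p11)^[N / K - 1] p01 /
              (1 - p11 + (beliefStep p01 p11)^[N / K - 1] p01) →
        ub = min (K * stationaryBelief p01 p11 / (1 - p11 + stationaryBelief p01 p11))
              (stationaryBelief p01 p11 * N) →
        (lb ≤ lowerThroughput P p01 p11 ω₁ S π ∧
          lowerThroughput P p01 p11 ω₁ S π ≤ lowerOptimal P K p01 p11 ω₁ S ∧
          lowerOptimal P K p01 p11 ω₁ S ≤ ub) ∧
        (lb ≤ upperThroughput P p01 p11 ω₁ S π ∧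
          upperThroughput P p01 p11 ω₁ S π ≤ upperOptimal P K p01 p11 ω₁ S ∧
          upperOptimal P K p01 p11 ω₁ S ≤ ub)) ∧
    (p11 < p01 →
      ∀ lb ub : ℝ,
        lb = K * p01 / (1 - (beliefStep p01 p11)^[2 * (N / K) - 2] p11 + p01) →
        ub = min (K * p01 / (1 - beliefStep p01 p11 p11 + p01))
              (stationaryBelief p01 p11 * N) →
        (lb ≤ lowerThroughput P p01 p11 ω₁ S π ∧
          lowerThroughput P p01 p11 ω₁ S π ≤ lowerOptimal P K p01 p11 ω₁ S ∧
          lowerOptimal P K p01 p11 ω₁ S ≤ ub) ∧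
        (lb ≤ upperThroughput P p01 p11 ω₁ S π ∧
          upperThroughput P p01 p11 ω₁ S π ≤ upperOptimal P K p01 p11 ω₁ S ∧
          upperOptimal P K p01 p11 ω₁ S ≤ ub)) := by
  refine ⟨?_, ?_⟩
  · rintro h _ _ rfl rfl
    exact hS.optimal_bounds
      (hS.le_lowerThroughput_whittle_of_le hK hKN h01 h11' h hω₁ hπ)
      fun σ => le_min (hS.upperThroughput_le_of_le h01 h11' h hω₁ σ)
        (hS.upperThroughput_le_stationaryBelief_mul h01 h01' h11 h11' hω₁ σ)
  · rintro h _ _ rfl rfl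
    exact hS.optimal_bounds
      (hS.le_lowerThroughput_whittle_of_ge hK hKN h11 h01' h hω₁ hπ)
      fun σ => le_min (hS.upperThroughput_le_of_ge h11 h01' h hω₁ σ)
        (hS.upperThroughput_le_stationaryBelief_mul h01 h01' h11 h11' hω₁ σ)
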